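/- For $a\in(0,1/2]$ and $r\in(0,1)$ put $r'=\sqrt{1-r^2}$ and $$\mathcal K_a(r)=\frac{\pi}{2}\,{}_2F_1(a,1-a;1;r^2),\qquad \mu_a(r)=\frac{\pi}{2\sin(\pi a)}\frac{\mathcal K_a(r')}{\mathcal K_a(r)},\qquad m_a(r)=\frac{2}{\pi\sin(\pi a)}\,r'^2\,\mathcal K_a(r')\,\mathcal K_a(r),$$ where ${}_2F_1$ is the Gaussian hypergeometric function. The function $\mu_a$ is a strictly decreasing bijection from $(0,1)$ onto $(0,\infty)$; for $K>0$ the generalized Hersch–Pfluger distortion function is $\varphi_K^a(r)=\mu_a^{-1}(\mu_a(r)/K)$. Let $\delta,\zeta,\eta$ be real-valued functions on $(0,1/2]\times(0,1)$. In each of the following equivalences, both sides are required for all $(a,r)\in(0,1/2]\times(0,1)$, and the left-hand side also for all $K\in(1,\infty)$. (1) If $0<p<1$, then $$\frac{\varphi_K^a(r)^p}{\varphi_K^a(r^p)}>e^{\delta(a,r)(1-1/K)}\iff \delta(a,r)\le p\,m_a(r)-m_a(r^p),$$ $$e^{\zeta(a,r)(1-K)}<\frac{\varphi_{1/K}^a(r)^p}{\varphi_{1/K}^a(r^p)}\iff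 \zeta(a,r)\ge p\,m_a(r)-m_a(r^p),$$ $$\frac{\varphi_{1/K}^a(r)^p}{\varphi_{1/K}^a(r^p)}<e^{\eta(a,r)(1-K)}\iff \eta(a,r)\le p\,\mu_a(r)-\mu_a(r^p).$$ If $p=1$, the same three equivalences hold with the strict inequalities on the left-hand sides replaced by the non-strict ones. (2) If $p>1$, then $$\frac{\varphi_K^a(r)^p}{\varphi_K^a(r^p)}<e^{\delta(a,r)(1-1/K)}\iff \delta(a,r)\ge p\,m_a(r)-m_a(r^p),$$ $$e^{\zeta(a,r)(1-K)}<\frac{\varphi_{1/K}^a(r)^p}{\varphi_{1/K}^a(r^p)}\iff \zeta(a,r)\ge p\,\mu_a(r)-\mu_a(r^p),$$ $$\frac{\varphi_{1/K}^a(r)^p}{\varphi_{1/K}^a(r^p)}<e^{\eta(a,r)(1-K)}\iff \eta(a,r)\le p\,m_a(r)-m_a(r^p).$$ -/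

import Mathlib

/-- The complementary modulus `r' = √(1 - r²)`. -/
noncomputable def compl_modulus (r : ℝ) : ℝ := Real.sqrt (1 - r ^ 2)

/-- The generalized elliptic integral of the first kind
`K_a(r) = (π / 2) F(a, 1 - a; 1; r²)`, for `0 < r < 1`. -/
noncomputable def ellipticK (a r : ℝ) : ℝ :=
  Real.pi / 2 * ordinaryHypergeometric a (1 - a) (1 : ℝ) (r ^ 2)

/-- The generalized Grötzsch ring function
`μ_a(r) = π / (2 sin (π a)) * K_a(r') / K_a(r)`, for `0 < r < 1`. -/
noncomputable def grotzschMu (a r : ℝ) : ℝ :=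
  Real.pi / (2 * Real.sin (Real.pi * a)) *
    (ellipticK a (compl_modulus r) / ellipticK a r)

/-- The function `m_a(r) = 2 / (π sin (π a)) * r'² * K_a(r') * K_a(r)`, for `0 < r < 1`. -/
noncomputable def hubnerM (a r : ℝ) : ℝ :=
  2 / (Real.pi * Real.sin (Real.pi * a)) *
    (compl_modulus r ^ 2 * ellipticK a (compl_modulus r) * ellipticK a r)

/-- The generalized Hersch–Pfluger distortion function `φ_K^a(r) = μ_a⁻¹(μ_a(r) / K)`, where
`μ_a⁻¹` is the inverse of the bijection `μ_a : (0, 1) → (0, ∞)`; for `0 < r < 1`, `0 < K`. -/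
noncomputable def herschPfluger (K a r : ℝ) : ℝ :=
  Function.invFunOn (grotzschMu a) (Set.Ioo 0 1) (grotzschMu a r / K)

/-!
The whole theorem rests on one fact: `m_a` is a strictly concave function of `log (1 / r)`.

With `z = r²` and `F(z) = F(a, 1 - a; 1; z)`, Legendre's relation (the Wronskian of `F(z)` and
`F(1 - z)`, `legendre_relation`) gives `-r μ_a'(r) = 1 / W` with
`W = (1 - z) F(z)² = m_a / μ_a`. Hence `X = log (1 / r)`, as a function of `y = μ_a(r)`, solves
`X' = W`, and a computation gives `y W' = W R` with
`R = (π / sin (π a)) · z F(1 - z) · (F - 2 (1 - z) F')`. The factor `z F(1 - z)` is strictly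
increasing in `z`, and `F - 2 (1 - z) F'` has nonnegative Taylor coefficients because
`a (1 - a) ≤ 1 / 4`, so `R` is strictly increasing in `r` (`hypR_strictMonoOn`), that is, strictly
decreasing in `y`. Since `d m_a / d X = 1 + R`, this is the concavity of `m_a`.

For `0 < p < 1` let `A = μ_a(r)`, `B = μ_a(r ^ p)` and `G(v) = p X(v A) - X(v B)`; then
`log (φ_K(r)^p / φ_K(r^p)) = -G(1 / K)` and `G(1) = 0`. The slope `H = G'` satisfies
`H(1) = p m_a(r) - m_a(r ^ p) ≤ 0` by concavity, and `H' < 0` wherever `H ≤ 0` by monotonicity of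
`R`. So `H > H(1)` on `(0, 1)`, whereas on `(1, ∞)` the slope decreases from `H(1)` to its limit
`p A - B = p μ_a(r) - μ_a(r ^ p)` (`LogSystem.secantBounds`). Consequently `G(v) / (v - 1)` exceeds
`H(1)` on `(0, 1)` and lies strictly between `p A - B` and `H(1)` on `(1, ∞)`, and these bounds are
approached as `v → 1` and `v → ∞`, which is the content of the three equivalences. The
case `p > 1` follows by applying this to `r ^ p` and `1 / p`.
-/

open Filter Topology Set

/-! ### Power series with bounded coefficients -/

theorem summable_mul_pow_of_bounded {c : ℕ → ℝ} {C : ℝ} (hc : ∀ n, |c n| ≤ C) {x : ℝ}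
    (hx : |x| < 1) : Summable fun n => c n * x ^ n := by
  refine Summable.of_norm_bounded ((summable_geometric_of_lt_one (abs_nonneg x) hx).mul_left C) ?_
  intro n
  rw [Real.norm_eq_abs, abs_mul, abs_pow]
  exact mul_le_mul_of_nonneg_right (hc n) (by positivity)

theorem hasDerivAt_tsum_mul_pow {c : ℕ → ℝ} {C : ℝ} (hc : ∀ n, |c n| ≤ C) {x : ℝ}
    (hx : |x| < 1) :
    HasDerivAt (fun z => ∑' n, c n * z ^ n) (∑' n : ℕ, ((n : ℝ) + 1) * c (n + 1) * x ^ n) x := by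
  obtain ⟨ρ, hxρ, hρ⟩ := exists_between hx
  have hρ0 : 0 < ρ := (abs_nonneg x).trans_lt hxρ
  have hC : 0 ≤ C := (abs_nonneg _).trans (hc 0)
  have hu : Summable fun n : ℕ => C * (n * ρ ^ (n - 1)) := by
    refine Summable.mul_left C ?_
    rw [← summable_nat_add_iff 1]
    have h1 : Summable fun n : ℕ => (n : ℝ) * ρ ^ n := by
      simpa using summable_pow_mul_geometric_of_norm_lt_one 1
        (show ‖ρ‖ < 1 by rwa [Real.norm_eq_abs, abs_of_pos hρ0])
    have h2 := h1.add (summable_geometric_of_lt_one hρ0.le hρ)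
    refine h2.congr fun n => ?_
    simp only [Nat.add_sub_cancel]
    push_cast
    ring
  have hbound : ∀ (n : ℕ) (y : ℝ), y ∈ Ioo (-ρ) ρ →
      ‖c n * (n * y ^ (n - 1))‖ ≤ C * (n * ρ ^ (n - 1)) := by
    intro n y hy
    rw [Real.norm_eq_abs, abs_mul, abs_mul, abs_pow, Nat.abs_cast]
    have : |y| ≤ ρ := (abs_lt.2 hy).le
    gcongr
    exact hc n
  have hx' : x ∈ Ioo (-ρ) ρ := abs_lt.1 hxρ
  have key := hasDerivAt_tsum_of_isPreconnected (g := fun n z => c n * z ^ n)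
    (g' := fun n z => c n * (n * z ^ (n - 1))) hu isOpen_Ioo isPreconnected_Ioo
    (fun n y _ => (hasDerivAt_pow n y).const_mul (c n)) hbound hx'
    (summable_mul_pow_of_bounded hc hx) hx'
  convert! key using 1
  have hs : Summable fun n : ℕ => c n * (n * x ^ (n - 1)) :=
    Summable.of_norm_bounded hu fun n => hbound n x hx'
  rw [hs.tsum_eq_zero_add]
  simp only [Nat.cast_zero, zero_mul, mul_zero, zero_add, Nat.add_sub_cancel]
  refine tsum_congr fun n => ?_
  push_cast
  ring

/-! ### The hypergeometric function `F(a, 1 - a; 1; z)` -/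

/-- The function `F(a, 1 - a; 1; z)`. -/
noncomputable abbrev hypF (a z : ℝ) : ℝ := ordinaryHypergeometric a (1 - a) (1 : ℝ) z

/-- The Taylor coefficients `(a)ₙ (1 - a)ₙ / (n!)²` of `F(a, 1 - a; 1; z)`. -/
noncomputable abbrev hypCoeff (a : ℝ) (n : ℕ) : ℝ :=
  ordinaryHypergeometricCoefficient a (1 - a) (1 : ℝ) n

/-- The power series `∑ a (1 - a) cₙ zⁿ / (n + 1)`, where the `cₙ` are the coefficients of
`F(a, 1 - a; 1; z)`. It equals `(1 - z) F'(z)`. -/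
noncomputable def hypB (a z : ℝ) : ℝ :=
  ∑' n : ℕ, a * (1 - a) * hypCoeff a n / (n + 1) * z ^ n

theorem hypF_eq_tsum (a z : ℝ) : hypF a z = ∑' n, hypCoeff a n * z ^ n := by
  simp only [hypF, ordinaryHypergeometric_eq_tsum, smul_eq_mul]

theorem hypCoeff_zero (a : ℝ) : hypCoeff a 0 = 1 := by
  simp [hypCoeff, ordinaryHypergeometricCoefficient]

theorem hypCoeff_eq (a : ℝ) (n : ℕ) :
    hypCoeff a n = (∏ j ∈ Finset.range n, (a + j)) * (∏ j ∈ Finset.range n, (1 - a + j)) /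
      (n.factorial : ℝ) ^ 2 := by
  have hev : ∀ x : ℝ, (ascPochhammer ℝ n).eval x = ∏ j ∈ Finset.range n, (x + j) := by
    intro x
    induction n with
    | zero => simp
    | succ n ih => rw [ascPochhammer_succ_eval, ih, Finset.prod_range_succ]
  simp only [hypCoeff, ordinaryHypergeometricCoefficient, hev]
  have : (∏ j ∈ Finset.range n, ((1 : ℝ) + j)) = n.factorial := by
    rw [← Finset.prod_range_add_one_eq_factorial]
    push_cast
    exact Finset.prod_congr rfl fun _ _ => add_comm _ _
  rw [this]
  field_simp

theorem hypCoeff_succ (a : ℝ) (n : ℕ) :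
    ((n : ℝ) + 1) * hypCoeff a (n + 1) =
      n * hypCoeff a n + a * (1 - a) * hypCoeff a n / (n + 1) := by
  rw [hypCoeff_eq, hypCoeff_eq, Finset.prod_range_succ, Finset.prod_range_succ,
    Nat.factorial_succ]
  push_cast
  have : (n.factorial : ℝ) ≠ 0 := by positivity
  field_simp
  ring

section

variable {a : ℝ}

theorem mul_one_sub_pos (ha : a ∈ Ioo (0 : ℝ) 1) : 0 < a * (1 - a) :=
  mul_pos ha.1 (sub_pos.2 ha.2)

theorem mul_one_sub_le (a : ℝ) : a * (1 - a) ≤ 1 / 4 := by nlinarith [sq_nonneg (a - 1 / 2)]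

theorem hypCoeff_pos (ha : a ∈ Ioo (0 : ℝ) 1) (n : ℕ) : 0 < hypCoeff a n := by
  rw [hypCoeff_eq]
  have h1 := ha.1
  have h2 := sub_pos.2 ha.2
  positivity

theorem hypCoeff_le_one (ha : a ∈ Ioo (0 : ℝ) 1) (n : ℕ) : hypCoeff a n ≤ 1 := by
  induction n with
  | zero => rw [hypCoeff_zero]
  | succ n ih =>
    have h := hypCoeff_succ a n
    have h0 := hypCoeff_pos ha n
    have h1 : a * (1 - a) * hypCoeff a n / (n + 1) ≤ 1 := by
      rw [div_le_one (by positivity)]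
      have := mul_one_sub_le a
      have hn : (0 : ℝ) ≤ n := n.cast_nonneg
      nlinarith
    have h2 : (n : ℝ) * hypCoeff a n ≤ n := mul_le_of_le_one_right n.cast_nonneg ih
    have h3 : ((n : ℝ) + 1) * hypCoeff a (n + 1) ≤ (n + 1) * 1 := by linarith
    exact le_of_mul_le_mul_left h3 (by positivity)

theorem hypCoeff_abs_le (ha : a ∈ Ioo (0 : ℝ) 1) (n : ℕ) : |hypCoeff a n| ≤ 1 := by
  rw [abs_of_pos (hypCoeff_pos ha n)]
  exact hypCoeff_le_one ha n

theorem hypB_coeff_pos (ha : a ∈ Ioo (0 : ℝ) 1) (n : ℕ) :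
    0 < a * (1 - a) * hypCoeff a n / (n + 1) := by
  have := mul_one_sub_pos ha
  have := hypCoeff_pos ha n
  positivity

theorem hypB_coeff_le (ha : a ∈ Ioo (0 : ℝ) 1) (n : ℕ) :
    a * (1 - a) * hypCoeff a n / (n + 1) ≤ hypCoeff a n / 4 := by
  have h1 := mul_one_sub_le a
  have h2 := hypCoeff_pos ha n
  have hn : (0 : ℝ) ≤ n := n.cast_nonneg
  rw [div_le_iff₀ (by positivity)]
  nlinarith [mul_nonneg h2.le hn]

theorem hypB_coeff_abs_le (ha : a ∈ Ioo (0 : ℝ) 1) (n : ℕ) :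
    |a * (1 - a) * hypCoeff a n / (n + 1)| ≤ 1 := by
  rw [abs_of_pos (hypB_coeff_pos ha n)]
  linarith [hypB_coeff_le ha n, hypCoeff_le_one ha n]

theorem hasSum_hypF (ha : a ∈ Ioo (0 : ℝ) 1) {z : ℝ} (hz : |z| < 1) :
    HasSum (fun n => hypCoeff a n * z ^ n) (hypF a z) := by
  rw [hypF_eq_tsum]
  exact (summable_mul_pow_of_bounded (hypCoeff_abs_le ha) hz).hasSum

theorem hasSum_hypB (ha : a ∈ Ioo (0 : ℝ) 1) {z : ℝ} (hz : |z| < 1) :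
    HasSum (fun n : ℕ => a * (1 - a) * hypCoeff a n / (n + 1) * z ^ n) (hypB a z) :=
  (summable_mul_pow_of_bounded (hypB_coeff_abs_le ha) hz).hasSum

theorem hasDerivAt_hypF (ha : a ∈ Ioo (0 : ℝ) 1) {z : ℝ} (hz : |z| < 1) :
    HasDerivAt (hypF a) (hypB a z / (1 - z)) z := by
  have h1z : 1 - z ≠ 0 := by linarith [(abs_lt.1 hz).2]
  have h := hasDerivAt_tsum_mul_pow (hypCoeff_abs_le ha) hz
  have hF : hypF a = fun z => ∑' n, hypCoeff a n * z ^ n := funext (hypF_eq_tsum a)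
  rw [hF]
  convert! h using 1
  rw [div_eq_iff h1z]
  -- the coefficients `dₙ = (n + 1) cₙ₊₁` of `F'` are bounded by `n + 1`
  have hd : Summable fun n : ℕ => ((n : ℝ) + 1) * hypCoeff a (n + 1) * z ^ n := by
    have h1 : Summable fun n : ℕ => (n : ℝ) * |z| ^ n := by
      simpa using summable_pow_mul_geometric_of_norm_lt_one 1
        (show ‖|z|‖ < 1 by rwa [Real.norm_eq_abs, abs_abs])
    refine Summable.of_norm_bounded (h1.add (summable_geometric_of_lt_one (abs_nonneg z) hz)) ?_
    intro n
    rw [Real.norm_eq_abs, abs_mul, abs_mul, abs_pow, abs_of_pos (by positivity : (0 : ℝ) < n + 1)]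
    have h2 := hypCoeff_abs_le ha (n + 1)
    have h3 : (0 : ℝ) ≤ |z| ^ n := by positivity
    calc ((n : ℝ) + 1) * |hypCoeff a (n + 1)| * |z| ^ n ≤ ((n : ℝ) + 1) * 1 * |z| ^ n := by
          gcongr
      _ = n * |z| ^ n + |z| ^ n := by ring
  have hd' : HasSum (fun n : ℕ => (n : ℝ) * hypCoeff a n * z ^ n)
      (z * ∑' n : ℕ, ((n : ℝ) + 1) * hypCoeff a (n + 1) * z ^ n) := by
    rw [← hasSum_nat_add_iff' 1]
    simp only [Finset.range_one, Finset.sum_singleton, Nat.cast_zero, zero_mul, sub_zero]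
    refine (hd.hasSum.mul_left z).congr_fun ?_ |> id
    intro n
    push_cast
    ring
  have hB := hd.hasSum.sub hd'
  have := (hasSum_hypB ha hz).unique (hB.congr_fun fun n => ?_)
  · rw [this]; ring
  · linear_combination (-z ^ n) * hypCoeff_succ a n

theorem hasDerivAt_mul_hypB (ha : a ∈ Ioo (0 : ℝ) 1) {z : ℝ} (hz : |z| < 1) :
    HasDerivAt (fun z => z * hypB a z) (a * (1 - a) * hypF a z) z := by
  -- the division by zero makes the constant coefficient vanish
  set e : ℕ → ℝ := fun n => a * (1 - a) * hypCoeff a (n - 1) / n with he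
  have he1 : ∀ n, |e n| ≤ 1 := by
    rintro (_ | n)
    · simp [he]
    · simpa [he] using hypB_coeff_abs_le ha n
  have h := hasDerivAt_tsum_mul_pow he1 hz
  have h1 : (fun z => z * hypB a z) =ᶠ[𝓝 z] fun z => ∑' n, e n * z ^ n := by
    filter_upwards [(isOpen_lt continuous_abs continuous_const).mem_nhds hz] with w hw
    rw [(summable_mul_pow_of_bounded he1 hw).tsum_eq_zero_add, hypB, ← tsum_mul_left]
    simp only [he, Nat.cast_zero, div_zero, zero_mul, zero_add, Nat.add_sub_cancel, Nat.cast_add,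
      Nat.cast_one]
    refine tsum_congr fun n => ?_
    ring
  refine (h.congr_of_eventuallyEq h1).congr_deriv ?_
  rw [hypF_eq_tsum, ← tsum_mul_left]
  refine tsum_congr fun n => ?_
  simp only [he, Nat.add_sub_cancel, Nat.cast_add, Nat.cast_one]
  field_simp

theorem abs_lt_one_of_mem {z : ℝ} (hz : z ∈ Ico (0 : ℝ) 1) : |z| < 1 := by
  rw [abs_of_nonneg hz.1]; exact hz.2

theorem one_le_hypF (ha : a ∈ Ioo (0 : ℝ) 1) {z : ℝ} (hz : z ∈ Ico (0 : ℝ) 1) :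
    1 ≤ hypF a z := by
  have h := le_hasSum (hasSum_hypF ha (abs_lt_one_of_mem hz)) 0 fun n _ =>
    mul_nonneg (hypCoeff_pos ha n).le (pow_nonneg hz.1 n)
  simpa [hypCoeff_zero] using h

theorem hypB_pos (ha : a ∈ Ioo (0 : ℝ) 1) {z : ℝ} (hz : z ∈ Ico (0 : ℝ) 1) :
    0 < hypB a z := by
  have h := le_hasSum (hasSum_hypB ha (abs_lt_one_of_mem hz)) 0 fun n _ =>
    mul_nonneg (hypB_coeff_pos ha n).le (pow_nonneg hz.1 n)
  exact (mul_pos (hypB_coeff_pos ha 0) (pow_pos one_pos 0)).trans_le (by simpa using h)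

theorem hypB_monotoneOn (ha : a ∈ Ioo (0 : ℝ) 1) : MonotoneOn (hypB a) (Ico 0 1) := by
  intro x hx y hy hxy
  refine hasSum_le (fun n => ?_) (hasSum_hypB ha (abs_lt_one_of_mem hx))
    (hasSum_hypB ha (abs_lt_one_of_mem hy))
  exact mul_le_mul_of_nonneg_left (pow_le_pow_left₀ hx.1 hxy n) (hypB_coeff_pos ha n).le

/-- `F - 2 (1 - z) F'` has nonnegative Taylor coefficients, because `a (1 - a) ≤ 1 / 4`. -/
theorem hypF_sub_two_mul_hypB_monotoneOn (ha : a ∈ Ioo (0 : ℝ) 1) :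
    MonotoneOn (fun z => hypF a z - 2 * hypB a z) (Ico 0 1) := by
  intro x hx y hy hxy
  have hs : ∀ z ∈ Ico (0 : ℝ) 1, HasSum (fun n : ℕ => (hypCoeff a n -
      2 * (a * (1 - a) * hypCoeff a n / (n + 1))) * z ^ n) (hypF a z - 2 * hypB a z) := by
    intro z hz
    refine ((hasSum_hypF ha (abs_lt_one_of_mem hz)).sub
      ((hasSum_hypB ha (abs_lt_one_of_mem hz)).mul_left 2)).congr_fun fun n => ?_
    ring
  refine hasSum_le (fun n => ?_) (hs x hx) (hs y hy)
  refine mul_le_mul_of_nonneg_left (pow_le_pow_left₀ hx.1 hxy n) ?_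
  linarith [hypB_coeff_le ha n, hypCoeff_pos ha n]

theorem hypB_zero (a : ℝ) : hypB a 0 = a * (1 - a) := by
  rw [hypB, tsum_eq_single 0]
  · simp [hypCoeff_zero]
  · intro n hn
    simp [hn]

theorem two_mul_hypB_lt_hypF (ha : a ∈ Ioo (0 : ℝ) 1) {z : ℝ} (hz : z ∈ Ico (0 : ℝ) 1) :
    2 * hypB a z < hypF a z := by
  have h := hypF_sub_two_mul_hypB_monotoneOn ha ⟨le_rfl, one_pos⟩ hz hz.1
  simp only [hypB_zero, hypF, ordinaryHypergeometric_zero] at h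
  have := mul_one_sub_le a
  simp only [hypF]
  linarith

end

section

variable {a : ℝ}

/-! ### Boundary behaviour and the Wronskian -/

theorem sin_pi_mul_pos (ha : a ∈ Ioo (0 : ℝ) 1) : 0 < Real.sin (Real.pi * a) :=
  Real.sin_pos_of_pos_of_lt_pi (mul_pos Real.pi_pos ha.1) (by nlinarith [Real.pi_pos, ha.2])

/-- The recursion for the coefficients makes the partial sums of `(1 - z) F'` at `z = 1`
telescope. -/
theorem sum_range_hypB_coeff (a : ℝ) (N : ℕ) :
    ∑ n ∈ Finset.range N, a * (1 - a) * hypCoeff a n / (n + 1) = N * hypCoeff a N := by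
  induction N with
  | zero => simp
  | succ N ih =>
    rw [Finset.sum_range_succ, ih]
    push_cast
    rw [hypCoeff_succ]

/-- Gauss' product for the Gamma function and the reflection formula give the growth of the
Taylor coefficients of `F(a, 1 - a; 1; z)`. -/
theorem tendsto_mul_hypCoeff (ha : a ∈ Ioo (0 : ℝ) 1) :
    Tendsto (fun N : ℕ => N * hypCoeff a N) atTop (𝓝 (Real.sin (Real.pi * a) / Real.pi)) := by
  rw [← tendsto_add_atTop_iff_nat 1]
  have h1 := (Real.GammaSeq_tendsto_Gamma a).mul (Real.GammaSeq_tendsto_Gamma (1 - a))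
  rw [Real.Gamma_mul_Gamma_one_sub] at h1
  have hs := sin_pi_mul_pos ha
  have h2 := h1.inv₀ (div_pos Real.pi_pos hs).ne'
  have h3 := (tendsto_natCast_div_add_atTop (1 : ℝ)).mul h2
  rw [one_mul, inv_div] at h3
  refine h3.congr' ?_
  filter_upwards [eventually_gt_atTop 0] with n hn
  have hn' : (0 : ℝ) < n := by exact_mod_cast hn
  have hpow : (n : ℝ) ^ a * (n : ℝ) ^ (1 - a) = n := by
    rw [← Real.rpow_add hn']; simp
  have ha0 := ha.1
  have ha1 := sub_pos.2 ha.2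
  have hp1 : 0 < ∏ j ∈ Finset.range (n + 1), (a + j) :=
    Finset.prod_pos fun j _ => by positivity
  have hp2 : 0 < ∏ j ∈ Finset.range (n + 1), (1 - a + j) :=
    Finset.prod_pos fun j _ => by positivity
  have hfac : (0 : ℝ) < n.factorial := by positivity
  rw [hypCoeff_eq, Real.GammaSeq, Real.GammaSeq, Nat.factorial_succ, ← mul_div_mul_comm,
    show (n : ℝ) ^ a * n.factorial * ((n : ℝ) ^ (1 - a) * n.factorial) =
      n * (n.factorial : ℝ) ^ 2 by linear_combination (n.factorial : ℝ) ^ 2 * hpow]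
  push_cast
  field_simp

theorem tendsto_hypB_one (ha : a ∈ Ioo (0 : ℝ) 1) :
    Tendsto (hypB a) (𝓝[<] 1) (𝓝 (Real.sin (Real.pi * a) / Real.pi)) := by
  refine Real.tendsto_tsum_powerSeries_nhdsWithin_lt
    (f := fun n : ℕ => a * (1 - a) * hypCoeff a n / (n + 1)) ?_
  simpa only [sum_range_hypB_coeff] using tendsto_mul_hypCoeff ha

theorem hasDerivAt_one_sub_mul_hypF_sq (ha : a ∈ Ioo (0 : ℝ) 1) {z : ℝ} (hz : |z| < 1) :
    HasDerivAt (fun z => (1 - z) * hypF a z ^ 2) (-hypF a z * (hypF a z - 2 * hypB a z)) z := by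
  have h1z : 1 - z ≠ 0 := by linarith [(abs_lt.1 hz).2]
  have h := ((hasDerivAt_id z).const_sub 1).mul ((hasDerivAt_hypF ha hz).pow 2)
  refine h.congr_deriv ?_
  simp only [id, Pi.pow_apply]
  push_cast
  field_simp
  ring

/-- `(1 - z) F²` decreases from its value `1` at `0`, so `F` grows at most like `(1 - z)^(-1/2)`;
in particular `z F(1 - z)` vanishes at `0`. -/
theorem one_sub_mul_hypF_sq_le (ha : a ∈ Ioo (0 : ℝ) 1) {z : ℝ} (hz : z ∈ Ico (0 : ℝ) 1) :
    (1 - z) * hypF a z ^ 2 ≤ 1 := by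
  have hanti : AntitoneOn (fun z => (1 - z) * hypF a z ^ 2) (Ico 0 1) := by
    refine antitoneOn_of_hasDerivWithinAt_nonpos (convex_Ico 0 1)
      (f' := fun z => -hypF a z * (hypF a z - 2 * hypB a z)) ?_ ?_ ?_
    · exact fun x hx =>
        (hasDerivAt_one_sub_mul_hypF_sq ha (abs_lt_one_of_mem hx)).continuousAt.continuousWithinAt
    · intro x hx
      rw [interior_Ico] at hx
      exact (hasDerivAt_one_sub_mul_hypF_sq ha
        (abs_lt_one_of_mem (Ioo_subset_Ico_self hx))).hasDerivWithinAt
    · intro x hx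
      rw [interior_Ico] at hx
      have h1 := one_le_hypF ha (Ioo_subset_Ico_self hx)
      have h2 := two_mul_hypB_lt_hypF ha (Ioo_subset_Ico_self hx)
      nlinarith
  have h := hanti ⟨le_rfl, one_pos⟩ hz hz.1
  simpa [hypF, ordinaryHypergeometric_zero] using h

theorem one_sub_mem {z : ℝ} (hz : z ∈ Ioo (0 : ℝ) 1) : 1 - z ∈ Ioo (0 : ℝ) 1 :=
  ⟨by linarith [hz.2], by linarith [hz.1]⟩

theorem mul_hypF_one_sub_le_sqrt (ha : a ∈ Ioo (0 : ℝ) 1) {z : ℝ} (hz : z ∈ Ioo (0 : ℝ) 1) :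
    z * hypF a (1 - z) ≤ √z := by
  refine Real.le_sqrt_of_sq_le ?_
  have h := one_sub_mul_hypF_sq_le ha (Ioo_subset_Ico_self (one_sub_mem hz))
  rw [sub_sub_cancel] at h
  nlinarith [hz.1]

/-- As `(1 - z) F'` increases from `a (1 - a)`, the function `F` is unbounded near `1`. -/
theorem hypF_log_lower_bound (ha : a ∈ Ioo (0 : ℝ) 1) {z : ℝ} (hz : z ∈ Ico (0 : ℝ) 1) :
    1 - a * (1 - a) * Real.log (1 - z) ≤ hypF a z := by
  have hderiv : ∀ x ∈ Ico (0 : ℝ) 1, HasDerivAt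
      (fun z => hypF a z + a * (1 - a) * Real.log (1 - z))
      (hypB a x / (1 - x) + a * (1 - a) * (-1 / (1 - x))) x := by
    intro x hx
    have h1x : 1 - x ≠ 0 := by linarith [hx.2]
    exact (hasDerivAt_hypF ha (abs_lt_one_of_mem hx)).add
      ((((hasDerivAt_id x).const_sub 1).log h1x).const_mul _)
  have hmono : MonotoneOn (fun z => hypF a z + a * (1 - a) * Real.log (1 - z)) (Ico 0 1) := by
    refine monotoneOn_of_hasDerivWithinAt_nonneg (convex_Ico 0 1)
      (f' := fun x => hypB a x / (1 - x) + a * (1 - a) * (-1 / (1 - x))) ?_ ?_ ?_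
    · exact fun x hx => (hderiv x hx).continuousAt.continuousWithinAt
    · intro x hx
      rw [interior_Ico] at hx
      exact (hderiv x (Ioo_subset_Ico_self hx)).hasDerivWithinAt
    · intro x hx
      rw [interior_Ico] at hx
      have h := hypB_monotoneOn ha ⟨le_rfl, one_pos⟩ (Ioo_subset_Ico_self hx) hx.1.le
      rw [hypB_zero] at h
      have h1x : 0 < 1 - x := by linarith [hx.2]
      have : hypB a x / (1 - x) + a * (1 - a) * (-1 / (1 - x)) =
          (hypB a x - a * (1 - a)) / (1 - x) := by ring
      rw [this]
      exact div_nonneg (by linarith) h1x.le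
  have h := hmono ⟨le_rfl, one_pos⟩ hz hz.1
  simp only [hypF, ordinaryHypergeometric_zero, sub_zero, Real.log_one, mul_zero, add_zero] at h
  simp only [hypF]
  linarith

theorem tendsto_one_sub_nhdsGT_zero : Tendsto (fun z : ℝ => 1 - z) (𝓝[>] 0) (𝓝[<] 1) := by
  refine tendsto_nhdsWithin_iff.2 ⟨?_, ?_⟩
  · have : Tendsto (fun z : ℝ => 1 - z) (𝓝 0) (𝓝 (1 - 0)) :=
      (continuous_const.sub continuous_id).tendsto 0
    rw [sub_zero] at this
    exact this.mono_left nhdsWithin_le_nhds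
  · filter_upwards [self_mem_nhdsWithin] with z hz
    simpa using hz

theorem hasDerivAt_hypF_one_sub (ha : a ∈ Ioo (0 : ℝ) 1) {z : ℝ} (hz : z ∈ Ioo (0 : ℝ) 1) :
    HasDerivAt (fun z => hypF a (1 - z)) (-(hypB a (1 - z) / z)) z := by
  have h := hasDerivAt_hypF ha (abs_lt_one_of_mem (Ioo_subset_Ico_self (one_sub_mem hz)))
  have h2 := h.comp z ((hasDerivAt_id z).const_sub 1)
  refine h2.congr_deriv ?_
  rw [sub_sub_cancel]
  ring

theorem tendsto_hypF_zero (ha : a ∈ Ioo (0 : ℝ) 1) :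
    Tendsto (hypF a) (𝓝[>] 0) (𝓝 1) := by
  have h := (hasDerivAt_hypF ha (z := 0) (by simp)).continuousAt.tendsto
  rw [hypF, ordinaryHypergeometric_zero] at h
  exact h.mono_left nhdsWithin_le_nhds

/-- Legendre's relation for `F(a, 1 - a; 1; z)`: the Wronskian of `F(z)` and `F(1 - z)`. -/
theorem legendre_relation (ha : a ∈ Ioo (0 : ℝ) 1) {z : ℝ} (hz : z ∈ Ioo (0 : ℝ) 1) :
    z * hypB a z * hypF a (1 - z) + hypF a z * ((1 - z) * hypB a (1 - z)) =
      Real.sin (Real.pi * a) / Real.pi := by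
  set Ω : ℝ → ℝ := fun z => z * hypB a z * hypF a (1 - z) +
    hypF a z * ((1 - z) * hypB a (1 - z)) with hΩ
  have hderiv : ∀ x ∈ Ioo (0 : ℝ) 1, HasDerivAt Ω 0 x := by
    intro x hx
    have hx1 := abs_lt_one_of_mem (Ioo_subset_Ico_self hx)
    have hx2 := abs_lt_one_of_mem (Ioo_subset_Ico_self (one_sub_mem hx))
    have h1 := (hasDerivAt_mul_hypB ha hx2).comp x ((hasDerivAt_id x).const_sub 1)
    have h := ((hasDerivAt_mul_hypB ha hx1).mul (hasDerivAt_hypF_one_sub ha hx)).add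
      ((hasDerivAt_hypF ha hx1).mul h1)
    refine h.congr_deriv ?_
    have hx0 : x ≠ 0 := hx.1.ne'
    have h1x : 1 - x ≠ 0 := (one_sub_mem hx).1.ne'
    simp only [Function.comp]
    field_simp
    ring
  have hconst : ∀ x ∈ Ioo (0 : ℝ) 1, Ω x = Ω z := fun x hx =>
    isOpen_Ioo.is_const_of_deriv_eq_zero isPreconnected_Ioo
      (fun w hw => (hderiv w hw).differentiableAt.differentiableWithinAt)
      (fun w hw => (hderiv w hw).deriv) hx hz
  have hev : ∀ᶠ x in 𝓝[>] (0 : ℝ), x ∈ Ioo (0 : ℝ) 1 := Ioo_mem_nhdsGT one_pos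
  -- the constant value is found by letting the argument tend to `0`
  have hlim1 : Tendsto Ω (𝓝[>] 0) (𝓝 (Ω z)) :=
    tendsto_const_nhds.congr' (hev.mono fun x hx => (hconst x hx).symm)
  have hA : Tendsto (fun x => x * hypF a (1 - x)) (𝓝[>] 0) (𝓝 0) := by
    have hsq : Tendsto (fun x : ℝ => √x) (𝓝[>] 0) (𝓝 0) := by
      have := Real.continuous_sqrt.tendsto 0
      rw [Real.sqrt_zero] at this
      exact this.mono_left nhdsWithin_le_nhds
    refine tendsto_of_tendsto_of_tendsto_of_le_of_le' tendsto_const_nhds hsq ?_ ?_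
    · filter_upwards [hev] with x hx
      exact mul_nonneg hx.1.le
        (zero_le_one.trans (one_le_hypF ha (Ioo_subset_Ico_self (one_sub_mem hx))))
    · filter_upwards [hev] with x hx using mul_hypF_one_sub_le_sqrt ha hx
  have hB : Tendsto (fun x => hypB a x * (x * hypF a (1 - x))) (𝓝[>] 0) (𝓝 0) := by
    refine tendsto_of_tendsto_of_tendsto_of_le_of_le' tendsto_const_nhds
      (by simpa using hA.mul (tendsto_hypF_zero ha)) ?_ ?_
    · filter_upwards [hev] with x hx
      have h1 := one_le_hypF ha (Ioo_subset_Ico_self (one_sub_mem hx))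
      have h2 := hypB_pos ha (Ioo_subset_Ico_self hx)
      have := hx.1
      positivity
    · filter_upwards [hev] with x hx
      have h1 := one_le_hypF ha (Ioo_subset_Ico_self (one_sub_mem hx))
      have h2 := hypB_pos ha (Ioo_subset_Ico_self hx)
      have h3 := two_mul_hypB_lt_hypF ha (Ioo_subset_Ico_self hx)
      rw [mul_comm]
      have := hx.1
      gcongr
      linarith
  have hC : Tendsto (fun x => hypF a x * ((1 - x) * hypB a (1 - x))) (𝓝[>] 0)
      (𝓝 (1 * (1 * (Real.sin (Real.pi * a) / Real.pi)))) :=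
    (tendsto_hypF_zero ha).mul ((tendsto_one_sub_nhdsGT_zero.mono_right nhdsWithin_le_nhds).mul
      ((tendsto_hypB_one ha).comp tendsto_one_sub_nhdsGT_zero))
  have hlim2 := hB.add hC
  rw [one_mul, one_mul, zero_add] at hlim2
  refine tendsto_nhds_unique hlim1 (hlim2.congr fun x => ?_)
  simp only [hΩ]
  ring

/-! ### The monotone factor -/

theorem mul_hypF_one_sub_strictMonoOn (ha : a ∈ Ioo (0 : ℝ) 1) :
    StrictMonoOn (fun z => z * hypF a (1 - z)) (Ioo 0 1) := by
  have hderiv : ∀ x ∈ Ioo (0 : ℝ) 1, HasDerivAt (fun z => z * hypF a (1 - z))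
      (hypF a (1 - x) - hypB a (1 - x)) x := by
    intro x hx
    refine ((hasDerivAt_id x).mul (hasDerivAt_hypF_one_sub ha hx)).congr_deriv ?_
    have hx0 : x ≠ 0 := hx.1.ne'
    simp only [id]
    field_simp
    ring
  refine strictMonoOn_of_hasDerivWithinAt_pos (convex_Ioo 0 1)
    (f' := fun x => hypF a (1 - x) - hypB a (1 - x)) ?_ ?_ ?_
  · exact fun x hx => (hderiv x hx).continuousAt.continuousWithinAt
  · intro x hx
    rw [interior_Ioo] at hx
    exact (hderiv x hx).hasDerivWithinAt
  · intro x hx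
    rw [interior_Ioo] at hx
    have h1 := hypB_pos ha (Ioo_subset_Ico_self (one_sub_mem hx))
    have h2 := two_mul_hypB_lt_hypF ha (Ioo_subset_Ico_self (one_sub_mem hx))
    linarith

/-- The function `(π / sin (π a)) z F(1 - z) (F(z) - 2 (1 - z) F'(z))`. With `z = r²` it is
`-1 - r m_a'(r)`. -/
noncomputable def hypR (a z : ℝ) : ℝ :=
  Real.pi / Real.sin (Real.pi * a) * (z * hypF a (1 - z) * (hypF a z - 2 * hypB a z))

theorem hypR_pos (ha : a ∈ Ioo (0 : ℝ) 1) {z : ℝ} (hz : z ∈ Ioo (0 : ℝ) 1) : 0 < hypR a z := by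
  have h1 := sin_pi_mul_pos ha
  have h2 := one_le_hypF ha (Ioo_subset_Ico_self (one_sub_mem hz))
  have h3 := sub_pos.2 (two_mul_hypB_lt_hypF ha (Ioo_subset_Ico_self hz))
  have h4 := hz.1
  have := Real.pi_pos
  unfold hypR
  positivity

theorem hypR_strictMonoOn (ha : a ∈ Ioo (0 : ℝ) 1) : StrictMonoOn (hypR a) (Ioo 0 1) := by
  intro x hx y hy hxy
  have h1 := sin_pi_mul_pos ha
  have h2 := mul_hypF_one_sub_strictMonoOn ha hx hy hxy
  have h3 := hypF_sub_two_mul_hypB_monotoneOn ha (Ioo_subset_Ico_self hx)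
    (Ioo_subset_Ico_self hy) hxy.le
  have h4 := sub_pos.2 (two_mul_hypB_lt_hypF ha (Ioo_subset_Ico_self hx))
  have h5 := one_le_hypF ha (Ioo_subset_Ico_self (one_sub_mem hy))
  have h6 := hy.1
  refine mul_lt_mul_of_pos_left ?_ (div_pos Real.pi_pos h1)
  refine mul_lt_mul h2 h3 h4 ?_
  positivity

end

/-! ### Solutions of the logarithmic system `X' = W`, `y W' = W R` -/

/-- The functions `X`, `W`, `R` on `(0, ∞)` satisfy `X' = W` and `y W' = W R`, where `R` is positive
and strictly decreasing, `X` vanishes at `0` and `W` tends to `1` at infinity. Here `y` stands for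
the value of `μ_a`, `X` for `log (1 / r)`, and `y W` for `m_a`; the last assertion on `R` says that
`m_a` is a strictly concave function of `log (1 / r)`. -/
structure LogSystem (X W R : ℝ → ℝ) : Prop where
  hasDerivAt_X : ∀ y, 0 < y → HasDerivAt X (W y) y
  hasDerivAt_W : ∀ y, 0 < y → HasDerivAt W (W y * R y / y) y
  X_pos : ∀ y, 0 < y → 0 < X y
  W_pos : ∀ y, 0 < y → 0 < W y
  R_pos : ∀ y, 0 < y → 0 < R y
  R_strictAnti : StrictAntiOn R (Ioi 0)
  tendsto_X : Tendsto X (𝓝[>] 0) (𝓝 0)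
  tendsto_W : Tendsto W atTop (𝓝 1)

/-- The graph of `G` over `(0, ∞)` passes through `(1, 0)` with slope `h` and lies below its tangent
line there, while over `(1, ∞)` it lies above the line of slope `l` through `(1, 0)`; both slopes
are optimal. -/
structure SecantBounds (G : ℝ → ℝ) (h l : ℝ) : Prop where
  lt_left : ∀ v, 0 < v → v < 1 → G v < h * (v - 1)
  lt_right : ∀ v, 1 < v → G v < h * (v - 1)
  gt_right : ∀ v, 1 < v → l * (v - 1) < G v
  hasDerivAt : HasDerivAt G h 1
  eq_zero : G 1 = 0
  tendsto : Tendsto (fun v => G v / (v - 1)) atTop (𝓝 l)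

namespace LogSystem

variable {X W R : ℝ → ℝ}

theorem X_strictMonoOn (S : LogSystem X W R) : StrictMonoOn X (Ioi 0) := by
  refine strictMonoOn_of_hasDerivWithinAt_pos (convex_Ioi 0) (f' := W) ?_ ?_ ?_
  · exact fun x hx => (S.hasDerivAt_X x hx).continuousAt.continuousWithinAt
  · intro x hx
    rw [interior_Ioi] at hx
    exact (S.hasDerivAt_X x hx).hasDerivWithinAt
  · intro x hx
    rw [interior_Ioi] at hx
    exact S.W_pos x hx

theorem W_strictMonoOn (S : LogSystem X W R) : StrictMonoOn W (Ioi 0) := by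
  refine strictMonoOn_of_hasDerivWithinAt_pos (convex_Ioi 0) (f' := fun y => W y * R y / y) ?_ ?_ ?_
  · exact fun x hx => (S.hasDerivAt_W x hx).continuousAt.continuousWithinAt
  · intro x hx
    rw [interior_Ioi] at hx
    exact (S.hasDerivAt_W x hx).hasDerivWithinAt
  · intro x hx
    rw [interior_Ioi] at hx
    exact div_pos (mul_pos (S.W_pos x hx) (S.R_pos x hx)) hx

theorem W_lt_one (S : LogSystem X W R) {y : ℝ} (hy : 0 < y) : W y < 1 := by
  have h1 : W y < W (y + 1) :=
    S.W_strictMonoOn hy (show (0 : ℝ) < y + 1 by linarith) (by linarith)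
  refine h1.trans_le (ge_of_tendsto S.tendsto_W ?_)
  filter_upwards [eventually_gt_atTop (y + 1)] with t ht
  exact (S.W_strictMonoOn (show (0 : ℝ) < y + 1 by linarith) (show (0 : ℝ) < t by linarith) ht).le

theorem exists_X_sub_eq (S : LogSystem X W R) {x y : ℝ} (hx : 0 < x) (hxy : x < y) :
    ∃ c ∈ Ioo x y, X y - X x = W c * (y - x) := by
  obtain ⟨c, hc, h⟩ := exists_hasDerivAt_eq_slope X W hxy
    (fun t ht => (S.hasDerivAt_X t (hx.trans_le ht.1)).continuousAt.continuousWithinAt)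
    (fun t ht => S.hasDerivAt_X t (hx.trans ht.1))
  refine ⟨c, hc, ?_⟩
  rw [h, div_mul_cancel₀ _ (sub_pos.2 hxy).ne']

theorem tendsto_X_div (S : LogSystem X W R) : Tendsto (fun y => X y / y) atTop (𝓝 1) := by
  -- lower bound by the mean value theorem on `[√y, y]`, upper bound from `W < 1`
  have hsqrt : Tendsto (fun y : ℝ => √y) atTop atTop := Real.tendsto_sqrt_atTop
  have hlow : Tendsto (fun y : ℝ => W (√y) * (1 - (√y)⁻¹)) atTop (𝓝 (1 * (1 - 0))) :=
    (S.tendsto_W.comp hsqrt).mul (tendsto_const_nhds.sub (tendsto_inv_atTop_zero.comp hsqrt))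
  have hup : Tendsto (fun y : ℝ => X 1 * y⁻¹ + 1) atTop (𝓝 (X 1 * 0 + 1)) :=
    (tendsto_inv_atTop_zero.const_mul _).add_const 1
  rw [sub_zero, one_mul] at hlow
  rw [mul_zero, zero_add] at hup
  refine tendsto_of_tendsto_of_tendsto_of_le_of_le' hlow hup ?_ ?_
  · filter_upwards [eventually_gt_atTop 1] with y hy
    have hy0 : 0 < y := by linarith
    have hs : 0 < √y := Real.sqrt_pos.2 hy0
    have hsy : √y * √y = y := Real.mul_self_sqrt hy0.le
    have hs1 : 1 < √y := by rw [Real.lt_sqrt] <;> linarith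
    have hlt : √y < y := by nlinarith
    obtain ⟨c, hc, h⟩ := S.exists_X_sub_eq hs hlt
    have h1 : W (√y) ≤ W c := (S.W_strictMonoOn hs (hs.trans hc.1) hc.1).le
    have h2 := S.X_pos _ hs
    rw [le_div_iff₀ hy0]
    have h3 : (1 - (√y)⁻¹) * y = y - √y := by
      rw [sub_mul, one_mul]
      congr 1
      nth_rewrite 2 [← hsy]
      field_simp
    rw [mul_assoc, h3]
    nlinarith [mul_le_mul_of_nonneg_right h1 (sub_pos.2 hlt).le]
  · filter_upwards [eventually_gt_atTop 1] with y hy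
    have hy0 : 0 < y := by linarith
    obtain ⟨c, hc, h⟩ := S.exists_X_sub_eq one_pos hy
    have h1 := S.W_lt_one (one_pos.trans hc.1)
    rw [div_le_iff₀ hy0, add_mul, mul_assoc, inv_mul_cancel₀ hy0.ne']
    nlinarith

theorem hasDerivAt_mul_W (S : LogSystem X W R) {y : ℝ} (hy : 0 < y) :
    HasDerivAt (fun y => y * W y) ((1 + R y) * W y) y := by
  refine ((hasDerivAt_id y).mul (S.hasDerivAt_W y hy)).congr_deriv ?_
  simp only [id]
  field_simp

/-- Cauchy's mean value theorem for `m = y W` as a function of `X`. -/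
theorem exists_mul_W_sub_eq (S : LogSystem X W R) {x y : ℝ} (hx : 0 < x) (hxy : x < y) :
    ∃ c ∈ Ioo x y, y * W y - x * W x = (1 + R c) * (X y - X x) := by
  obtain ⟨c, hc, h⟩ := exists_ratio_hasDerivAt_eq_ratio_slope X W hxy
    (fun t ht => (S.hasDerivAt_X t (hx.trans_le ht.1)).continuousAt.continuousWithinAt)
    (fun t ht => S.hasDerivAt_X t (hx.trans ht.1)) (fun y => y * W y) (fun y => (1 + R y) * W y)
    (fun t ht => (S.hasDerivAt_mul_W (hx.trans_le ht.1)).continuousAt.continuousWithinAt)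
    (fun t ht => S.hasDerivAt_mul_W (hx.trans ht.1))
  refine ⟨c, hc, mul_right_cancel₀ (S.W_pos c (hx.trans hc.1)).ne' ?_⟩
  linear_combination h

/-- A nonnegative concave function `m` of `X ∈ (0, ∞)` satisfies `p m(X) ≤ m(p X)`. -/
theorem mul_mul_W_le (S : LogSystem X W R) {p A B : ℝ} (hp0 : 0 < p) (hp1 : p < 1) (hA : 0 < A)
    (hB : 0 < B) (hAB : X B = p * X A) : B < A ∧ p * (A * W A) ≤ B * W B := by
  have hXA := S.X_pos A hA
  have hBA : B < A := by
    refine (S.X_strictMonoOn.lt_iff_lt hB hA).1 ?_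
    rw [hAB]
    nlinarith
  refine ⟨hBA, ?_⟩
  obtain ⟨c, hc, h⟩ := S.exists_mul_W_sub_eq hB hBA
  have hRc := S.R_pos c (hB.trans hc.1)
  have hlow : (1 + R c) * X B ≤ B * W B := by
    have hlim : Tendsto (fun e => (1 + R c) * (X B - X e)) (𝓝[>] 0) (𝓝 ((1 + R c) * (X B - 0))) :=
      (S.tendsto_X.const_sub _).const_mul _
    rw [sub_zero] at hlim
    refine le_of_tendsto hlim ?_
    filter_upwards [Ioo_mem_nhdsGT hB] with e he
    obtain ⟨d, hd, h'⟩ := S.exists_mul_W_sub_eq he.1 he.2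
    have h1 : R c ≤ R d :=
      (S.R_strictAnti (he.1.trans hd.1) (hB.trans hc.1) (hd.2.trans hc.1)).le
    have h2 := mul_pos he.1 (S.W_pos e he.1)
    have h3 := S.X_strictMonoOn he.1 hB he.2
    nlinarith
  have h1 : X A - X B = (1 - p) * X A := by rw [hAB]; ring
  rw [h1] at h
  have h2 : p * (A * W A) = p * (B * W B) + (1 - p) * ((1 + R c) * X B) := by
    rw [hAB]; linear_combination p * h
  nlinarith

theorem hasDerivAt_diff (S : LogSystem X W R) (p : ℝ) {A B v : ℝ} (hA : 0 < A) (hB : 0 < B)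
    (hv : 0 < v) : HasDerivAt (fun v => p * X (v * A) - X (v * B))
      (p * A * W (v * A) - B * W (v * B)) v := by
  have h1 := (S.hasDerivAt_X _ (mul_pos hv hA)).comp v ((hasDerivAt_id v).mul_const A)
  have h2 := (S.hasDerivAt_X _ (mul_pos hv hB)).comp v ((hasDerivAt_id v).mul_const B)
  refine ((h1.const_mul p).sub h2).congr_deriv ?_
  ring

theorem hasDerivAt_slope (S : LogSystem X W R) (p : ℝ) {A B v : ℝ} (hA : 0 < A) (hB : 0 < B)
    (hv : 0 < v) : HasDerivAt (fun v => p * A * W (v * A) - B * W (v * B))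
      ((p * A * W (v * A) * R (v * A) - B * W (v * B) * R (v * B)) / v) v := by
  have h1 := (S.hasDerivAt_W _ (mul_pos hv hA)).comp v ((hasDerivAt_id v).mul_const A)
  have h2 := (S.hasDerivAt_W _ (mul_pos hv hB)).comp v ((hasDerivAt_id v).mul_const B)
  refine ((h1.const_mul (p * A)).sub (h2.const_mul B)).congr_deriv ?_
  field_simp

/-- Where the slope of `p X(v A) - X(v B)` is nonpositive, it is strictly decreasing, because
`R(v A) < R(v B)`. -/
theorem slope_deriv_neg (S : LogSystem X W R) {p A B v : ℝ} (hB : 0 < B) (hBA : B < A)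
    (hv : 0 < v) (h : p * A * W (v * A) - B * W (v * B) ≤ 0) :
    (p * A * W (v * A) * R (v * A) - B * W (v * B) * R (v * B)) / v < 0 := by
  have hvA : 0 < v * A := mul_pos hv (hB.trans hBA)
  have hvB : 0 < v * B := mul_pos hv hB
  refine div_neg_of_neg_of_pos ?_ hv
  have h1 := S.R_pos _ hvA
  have h2 : R (v * A) < R (v * B) := S.R_strictAnti hvB hvA (mul_lt_mul_of_pos_left hBA hv)
  have h3 := mul_pos hB (S.W_pos _ hvB)
  nlinarith

end LogSystem

/-- A function which has negative derivative wherever it is nonpositive decreases once it is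
nonpositive. -/
theorem lt_of_deriv_neg_of_nonpos {H H' : ℝ → ℝ} {u v : ℝ} (huv : u < v)
    (hH : ∀ t ∈ Icc u v, HasDerivAt H (H' t) t) (hH' : ∀ t ∈ Icc u v, H t ≤ 0 → H' t < 0)
    (hu : H u ≤ 0) : H v < H u := by
  have hcont : ContinuousOn H (Icc u v) := fun t ht => (hH t ht).continuousAt.continuousWithinAt
  have hle : ∀ t ∈ Icc u v, H t ≤ H u := fun t ht =>
    image_le_of_deriv_right_lt_deriv_boundary' (B := fun _ => H u) (B' := fun _ => 0) hcont
      (fun x hx => (hH x (Ico_subset_Icc_self hx)).hasDerivWithinAt) le_rfl continuousOn_const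
      (fun x _ => hasDerivWithinAt_const x _ (H u))
      (fun x hx hxu => hH' x (Ico_subset_Icc_self hx) (hxu.le.trans hu)) ht
  have hanti : StrictAntiOn H (Icc u v) := by
    refine strictAntiOn_of_hasDerivWithinAt_neg (convex_Icc u v) hcont (f' := H') ?_ ?_
    · exact fun x hx => (hH x (interior_subset hx)).hasDerivWithinAt
    · exact fun x hx => hH' x (interior_subset hx) ((hle x (interior_subset hx)).trans hu)
  exact hanti (left_mem_Icc.2 huv.le) (right_mem_Icc.2 huv.le) huv

/-- The slope `H` of `G v = p X(v A) - X(v B)` is nonpositive at `1` and can only decrease once it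
is nonpositive. Hence `H > H 1` on `(0, 1)`, while `H` decreases from `H 1` to its limit `p A - B`
on `(1, ∞)`; the mean value theorem turns this into bounds for `G`. -/
theorem LogSystem.secantBounds {X W R : ℝ → ℝ} (S : LogSystem X W R) {p A B : ℝ} (hp0 : 0 < p)
    (hp1 : p < 1) (hA : 0 < A) (hB : 0 < B) (hAB : X B = p * X A) :
    SecantBounds (fun v => p * X (v * A) - X (v * B)) (p * (A * W A) - B * W B) (p * A - B) := by
  obtain ⟨hBA, hm⟩ := S.mul_mul_W_le hp0 hp1 hA hB hAB
  set G : ℝ → ℝ := fun v => p * X (v * A) - X (v * B) with hG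
  set H : ℝ → ℝ := fun v => p * A * W (v * A) - B * W (v * B) with hH
  have hGH : ∀ v, 0 < v → HasDerivAt G (H v) v := fun v hv => S.hasDerivAt_diff p hA hB hv
  have hH1 : H 1 = p * (A * W A) - B * W B := by simp only [hH, one_mul]; ring
  have hH1' : H 1 ≤ 0 := by rw [hH1]; linarith
  have hG1 : G 1 = 0 := by simp only [hG, one_mul, hAB]; ring
  have hstep : ∀ u v, 0 < u → u < v → H u ≤ 0 → H v < H u := fun u v hu huv h =>
    lt_of_deriv_neg_of_nonpos huv (fun t ht => S.hasDerivAt_slope p hA hB (hu.trans_le ht.1))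
      (fun t ht => S.slope_deriv_neg hB hBA (hu.trans_le ht.1)) h
  have hlim : Tendsto H atTop (𝓝 (p * A - B)) := by
    have h1 := (S.tendsto_W.comp (tendsto_id.atTop_mul_const hA)).const_mul (p * A)
    have h2 := (S.tendsto_W.comp (tendsto_id.atTop_mul_const hB)).const_mul B
    simpa using h1.sub h2
  have hmvt : ∀ u v, 0 < u → u < v → ∃ c ∈ Ioo u v, G v - G u = H c * (v - u) := by
    intro u v hu huv
    obtain ⟨c, hc, h⟩ := exists_hasDerivAt_eq_slope G H huv
      (fun t ht => (hGH t (hu.trans_le ht.1)).continuousAt.continuousWithinAt)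
      (fun t ht => hGH t (hu.trans ht.1))
    exact ⟨c, hc, by rw [h, div_mul_cancel₀ _ (sub_pos.2 huv).ne']⟩
  have hgt : ∀ v, 1 < v → p * A - B < H v := by
    intro v hv
    have hv0 : 0 < v := one_pos.trans hv
    have hHv : H v ≤ 0 := (hstep 1 v one_pos hv hH1').le.trans hH1'
    have h2 := hstep v (v + 1) hv0 (by linarith) hHv
    refine (le_of_tendsto hlim ?_).trans_lt h2
    filter_upwards [eventually_gt_atTop (v + 1)] with t ht
    exact (hstep (v + 1) t (by linarith) ht (h2.le.trans hHv)).le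
  rw [← hH1]
  refine ⟨?_, ?_, ?_, hGH 1 one_pos, hG1, ?_⟩
  · intro v hv0 hv1
    obtain ⟨c, hc, h⟩ := hmvt v 1 hv0 hv1
    have hHc : H 1 < H c := by
      by_contra! hcon
      exact absurd (hstep c 1 (hv0.trans hc.1) hc.2 (hcon.trans hH1')) (not_lt.2 hcon)
    rw [hG1] at h
    nlinarith
  · intro v hv1
    obtain ⟨c, hc, h⟩ := hmvt 1 v one_pos hv1
    have hHc := hstep 1 c one_pos hc.1 hH1'
    rw [hG1] at h
    nlinarith
  · intro v hv1
    obtain ⟨c, hc, h⟩ := hmvt 1 v one_pos hv1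
    have hHc := hgt c hc.1
    rw [hG1] at h
    nlinarith
  · have hXdiv : ∀ D, 0 < D → Tendsto (fun v => X (v * D) / v) atTop (𝓝 D) := by
      intro D hD
      have h := (S.tendsto_X_div.comp (tendsto_id.atTop_mul_const hD)).const_mul D
      rw [mul_one] at h
      refine h.congr' ?_
      filter_upwards [eventually_gt_atTop 0] with v hv
      simp only [Function.comp, id]
      field_simp
    have h1 : Tendsto (fun v => G v / v) atTop (𝓝 (p * A - B)) := by
      refine (((hXdiv A hA).const_mul p).sub (hXdiv B hB)).congr fun v => ?_
      simp only [hG]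
      ring
    have h2 : Tendsto (fun v : ℝ => (1 - v⁻¹)⁻¹) atTop (𝓝 (1 - 0)⁻¹) :=
      (tendsto_const_nhds.sub tendsto_inv_atTop_zero).inv₀ (by norm_num)
    have h3 := h1.mul h2
    rw [sub_zero, inv_one, mul_one] at h3
    refine h3.congr' ?_
    filter_upwards [eventually_gt_atTop 1] with v hv
    have : v - 1 ≠ 0 := by linarith
    field_simp

namespace SecantBounds

variable {G : ℝ → ℝ} {h l : ℝ}

theorem tendsto_slope_one (S : SecantBounds G h l) :
    Tendsto (fun v => G v / (v - 1)) (𝓝[≠] 1) (𝓝 h) := by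
  refine (hasDerivAt_iff_tendsto_slope.1 S.hasDerivAt).congr fun v => ?_
  rw [slope_def_field, S.eq_zero, sub_zero]

theorem forall_left_iff (S : SecantBounds G h l) (d : ℝ) :
    (∀ K : ℝ, 1 < K → d * (1 - 1 / K) < -G (1 / K)) ↔ d ≤ h := by
  refine ⟨fun H => ?_, fun hd K hK => ?_⟩
  · refine ge_of_tendsto (S.tendsto_slope_one.mono_left (nhdsLT_le_nhdsNE 1)) ?_
    filter_upwards [Ioo_mem_nhdsLT one_pos] with v hv
    have h1 := H v⁻¹ ((one_lt_inv₀ hv.1).2 hv.2)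
    rw [one_div, inv_inv] at h1
    rw [le_div_iff_of_neg (by linarith [hv.2])]
    linarith
  · have hK0 : 0 < K := by linarith
    have h1 : 1 / K < 1 := (div_lt_one hK0).2 hK
    have h2 := S.lt_left (1 / K) (by positivity) h1
    nlinarith

theorem forall_right_lt_iff (S : SecantBounds G h l) (d : ℝ) :
    (∀ K : ℝ, 1 < K → d * (1 - K) < -G K) ↔ h ≤ d := by
  refine ⟨fun H => ?_, fun hd K hK => ?_⟩
  · refine le_of_tendsto (S.tendsto_slope_one.mono_left (nhdsGT_le_nhdsNE 1)) ?_
    filter_upwards [self_mem_nhdsWithin] with v hv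
    have hv' : 1 < v := hv
    have h1 := H v hv'
    rw [div_le_iff₀ (by linarith)]
    linarith
  · have h2 := S.lt_right K hK
    nlinarith

theorem forall_right_gt_iff (S : SecantBounds G h l) (d : ℝ) :
    (∀ K : ℝ, 1 < K → -G K < d * (1 - K)) ↔ d ≤ l := by
  refine ⟨fun H => ?_, fun hd K hK => ?_⟩
  · refine ge_of_tendsto S.tendsto ?_
    filter_upwards [eventually_gt_atTop 1] with v hv
    have h1 := H v hv
    rw [le_div_iff₀ (by linarith)]
    linarith
  · have h2 := S.gt_right K hK
    nlinarith

end SecantBounds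

/-! ### The functions `μ_a`, `m_a` and the inverse of `μ_a` -/

section

variable {a r : ℝ}

/-- `r'² K_a(r)²`, normalized to be `1` at `r = 0`; this is the quotient `m_a / μ_a`. -/
noncomputable def hypW (a r : ℝ) : ℝ := (1 - r ^ 2) * hypF a (r ^ 2) ^ 2

/-- The inverse function of `μ_a : (0, 1) → (0, ∞)`. -/
noncomputable abbrev invMu (a y : ℝ) : ℝ := Function.invFunOn (grotzschMu a) (Ioo 0 1) y

theorem sq_mem_Ioo (hr : r ∈ Ioo (0 : ℝ) 1) : r ^ 2 ∈ Ioo (0 : ℝ) 1 :=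
  ⟨pow_pos hr.1 2, pow_lt_one₀ hr.1.le hr.2 two_ne_zero⟩

theorem compl_modulus_sq (hr : r ∈ Ioo (0 : ℝ) 1) : compl_modulus r ^ 2 = 1 - r ^ 2 :=
  Real.sq_sqrt (one_sub_mem (sq_mem_Ioo hr)).1.le

theorem grotzschMu_eq (hr : r ∈ Ioo (0 : ℝ) 1) : grotzschMu a r =
    Real.pi / (2 * Real.sin (Real.pi * a)) * (hypF a (1 - r ^ 2) / hypF a (r ^ 2)) := by
  rw [grotzschMu, ellipticK, ellipticK, compl_modulus_sq hr,
    mul_div_mul_left _ _ (by positivity : Real.pi / 2 ≠ 0)]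

theorem hypF_sq_pos (ha : a ∈ Ioo (0 : ℝ) 1) (hr : r ∈ Ioo (0 : ℝ) 1) : 0 < hypF a (r ^ 2) :=
  one_pos.trans_le (one_le_hypF ha (Ioo_subset_Ico_self (sq_mem_Ioo hr)))

theorem hypF_one_sub_sq_pos (ha : a ∈ Ioo (0 : ℝ) 1) (hr : r ∈ Ioo (0 : ℝ) 1) :
    0 < hypF a (1 - r ^ 2) :=
  one_pos.trans_le (one_le_hypF ha (Ioo_subset_Ico_self (one_sub_mem (sq_mem_Ioo hr))))

theorem hypW_pos (ha : a ∈ Ioo (0 : ℝ) 1) (hr : r ∈ Ioo (0 : ℝ) 1) : 0 < hypW a r :=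
  mul_pos (one_sub_mem (sq_mem_Ioo hr)).1 (pow_pos (hypF_sq_pos ha hr) 2)

theorem hubnerM_eq (ha : a ∈ Ioo (0 : ℝ) 1) (hr : r ∈ Ioo (0 : ℝ) 1) :
    hubnerM a r = grotzschMu a r * hypW a r := by
  have hF := hypF_sq_pos ha hr
  have hs := sin_pi_mul_pos ha
  rw [grotzschMu_eq hr, hubnerM, ellipticK, ellipticK, compl_modulus_sq hr, hypW]
  field_simp

theorem grotzschMu_pos (ha : a ∈ Ioo (0 : ℝ) 1) (hr : r ∈ Ioo (0 : ℝ) 1) :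
    0 < grotzschMu a r := by
  have h1 := hypF_sq_pos ha hr
  have h2 := hypF_one_sub_sq_pos ha hr
  have h3 := sin_pi_mul_pos ha
  rw [grotzschMu_eq hr]
  positivity

theorem hasDerivAt_grotzschMu (ha : a ∈ Ioo (0 : ℝ) 1) (hr : r ∈ Ioo (0 : ℝ) 1) :
    HasDerivAt (grotzschMu a) (-(r * hypW a r)⁻¹) r := by
  have hz := sq_mem_Ioo hr
  have hF := hypF_sq_pos ha hr
  have hs := sin_pi_mul_pos ha
  have hr0 := hr.1
  have hr1 := (one_sub_mem hz).1
  have hsq : HasDerivAt (fun r : ℝ => r ^ 2) (2 * r) r := by simpa using hasDerivAt_pow 2 r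
  have h1 := HasDerivAt.comp (h := fun r : ℝ => r ^ 2) r
    (hasDerivAt_hypF ha (abs_lt_one_of_mem (Ioo_subset_Ico_self hz))) hsq
  have h2 := HasDerivAt.comp (h := fun r : ℝ => r ^ 2) r (hasDerivAt_hypF_one_sub ha hz) hsq
  have h3 := (h2.div h1 hF.ne').const_mul (Real.pi / (2 * Real.sin (Real.pi * a)))
  have hev : grotzschMu a =ᶠ[𝓝 r] fun r => Real.pi / (2 * Real.sin (Real.pi * a)) *
      (hypF a (1 - r ^ 2) / hypF a (r ^ 2)) := by
    filter_upwards [isOpen_Ioo.mem_nhds hr] with x hx using grotzschMu_eq hx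
  refine (HasDerivAt.congr_of_eventuallyEq h3 hev).congr_deriv ?_
  have hL := legendre_relation ha hz
  rw [eq_div_iff Real.pi_ne_zero] at hL
  simp only [Function.comp, hypW]
  field_simp
  linear_combination -hL

theorem grotzschMu_strictAntiOn (ha : a ∈ Ioo (0 : ℝ) 1) :
    StrictAntiOn (grotzschMu a) (Ioo 0 1) := by
  refine strictAntiOn_of_hasDerivWithinAt_neg (convex_Ioo 0 1)
    (f' := fun r => -(r * hypW a r)⁻¹) ?_ ?_ ?_
  · exact fun x hx => (hasDerivAt_grotzschMu ha hx).continuousAt.continuousWithinAt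
  · intro x hx
    rw [interior_Ioo] at hx
    exact (hasDerivAt_grotzschMu ha hx).hasDerivWithinAt
  · intro x hx
    rw [interior_Ioo] at hx
    exact neg_neg_of_pos (inv_pos.2 (mul_pos hx.1 (hypW_pos ha hx)))

theorem tendsto_hypF_one (ha : a ∈ Ioo (0 : ℝ) 1) : Tendsto (hypF a) (𝓝[<] 1) atTop := by
  have h1 : Tendsto (fun z : ℝ => 1 - z) (𝓝[<] 1) (𝓝[>] 0) := by
    refine tendsto_nhdsWithin_iff.2 ⟨?_, ?_⟩
    · have : Tendsto (fun z : ℝ => 1 - z) (𝓝 1) (𝓝 (1 - 1)) :=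
        (continuous_const.sub continuous_id).tendsto 1
      rw [sub_self] at this
      exact this.mono_left nhdsWithin_le_nhds
    · filter_upwards [self_mem_nhdsWithin] with z hz
      simpa using hz
  have h2 := Real.tendsto_log_nhdsGT_zero.comp h1
  have h3 := tendsto_atTop_add_const_left _ (1 : ℝ)
    (tendsto_neg_atBot_atTop.comp (h2.const_mul_atBot (mul_one_sub_pos ha)))
  refine tendsto_atTop_mono' _ ?_ h3
  filter_upwards [Ioo_mem_nhdsLT one_pos] with z hz
  have := hypF_log_lower_bound ha (Ioo_subset_Ico_self hz)
  simp only [Function.comp]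
  linarith

theorem tendsto_sq_nhdsGT_zero : Tendsto (fun r : ℝ => r ^ 2) (𝓝[>] 0) (𝓝[>] 0) := by
  refine tendsto_nhdsWithin_iff.2 ⟨?_, ?_⟩
  · have : Tendsto (fun z : ℝ => z ^ 2) (𝓝 0) (𝓝 (0 ^ 2)) := (continuous_pow 2).tendsto 0
    rw [zero_pow two_ne_zero] at this
    exact this.mono_left nhdsWithin_le_nhds
  · filter_upwards [self_mem_nhdsWithin] with z hz using pow_pos (show (0 : ℝ) < z from hz) 2

theorem tendsto_grotzschMu_zero (ha : a ∈ Ioo (0 : ℝ) 1) :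
    Tendsto (grotzschMu a) (𝓝[>] 0) atTop := by
  have h1 := (tendsto_hypF_one ha).comp (tendsto_one_sub_nhdsGT_zero.comp tendsto_sq_nhdsGT_zero)
  have h2 := ((tendsto_hypF_zero ha).comp tendsto_sq_nhdsGT_zero).inv₀ one_ne_zero
  rw [inv_one] at h2
  have h3 := (h1.atTop_mul_pos one_pos h2).const_mul_atTop
    (div_pos Real.pi_pos (mul_pos two_pos (sin_pi_mul_pos ha)))
  refine h3.congr' ?_
  filter_upwards [Ioo_mem_nhdsGT one_pos] with x hx
  rw [grotzschMu_eq hx, div_eq_mul_inv (hypF a _)]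
  rfl

theorem tendsto_grotzschMu_one (ha : a ∈ Ioo (0 : ℝ) 1) :
    Tendsto (grotzschMu a) (𝓝[<] 1) (𝓝 0) := by
  have hsq : Tendsto (fun r : ℝ => r ^ 2) (𝓝[<] 1) (𝓝[<] 1) := by
    refine tendsto_nhdsWithin_iff.2 ⟨?_, ?_⟩
    · have : Tendsto (fun z : ℝ => z ^ 2) (𝓝 1) (𝓝 (1 ^ 2)) := (continuous_pow 2).tendsto 1
      rw [one_pow] at this
      exact this.mono_left nhdsWithin_le_nhds
    · filter_upwards [Ioo_mem_nhdsLT one_pos] with z hz using (sq_mem_Ioo hz).2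
  have h0 : Tendsto (fun r : ℝ => 1 - r ^ 2) (𝓝[<] 1) (𝓝[>] 0) := by
    refine tendsto_nhdsWithin_iff.2 ⟨?_, ?_⟩
    · have : Tendsto (fun r : ℝ => 1 - r ^ 2) (𝓝[<] 1) (𝓝 (1 - 1)) :=
        (hsq.mono_right nhdsWithin_le_nhds).const_sub 1
      rwa [sub_self] at this
    · filter_upwards [Ioo_mem_nhdsLT one_pos] with z hz using (one_sub_mem (sq_mem_Ioo hz)).1
  have h1 := (tendsto_hypF_zero ha).comp h0
  have h2 := tendsto_inv_atTop_zero.comp ((tendsto_hypF_one ha).comp hsq)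
  have h3 := (h1.mul h2).const_mul (Real.pi / (2 * Real.sin (Real.pi * a)))
  rw [mul_zero, mul_zero] at h3
  refine h3.congr' ?_
  filter_upwards [Ioo_mem_nhdsLT one_pos] with x hx
  rw [grotzschMu_eq hx, div_eq_mul_inv (hypF a _)]
  rfl

theorem grotzschMu_bijOn (ha : a ∈ Ioo (0 : ℝ) 1) : BijOn (grotzschMu a) (Ioo 0 1) (Ioi 0) := by
  refine ⟨fun r hr => grotzschMu_pos ha hr, (grotzschMu_strictAntiOn ha).injOn, fun y hy => ?_⟩
  have hev₁ : ∀ᶠ x in 𝓝[>] (0 : ℝ), x ∈ Ioo (0 : ℝ) 1 := Ioo_mem_nhdsGT one_pos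
  have hev₂ : ∀ᶠ x in 𝓝[<] (1 : ℝ), x ∈ Ioo (0 : ℝ) 1 := Ioo_mem_nhdsLT one_pos
  obtain ⟨r₁, hr₁, h₁⟩ :=
    (hev₁.and ((tendsto_grotzschMu_zero ha).eventually_gt_atTop y)).exists
  obtain ⟨r₂, hr₂, h₂⟩ :=
    (hev₂.and ((tendsto_grotzschMu_one ha).eventually_lt_const (show (0 : ℝ) < y from hy))).exists
  exact isPreconnected_Ioo.intermediate_value hr₂ hr₁
    (fun x hx => (hasDerivAt_grotzschMu ha hx).continuousAt.continuousWithinAt) ⟨h₂.le, h₁.le⟩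

theorem invMu_mem (ha : a ∈ Ioo (0 : ℝ) 1) {y : ℝ} (hy : 0 < y) : invMu a y ∈ Ioo (0 : ℝ) 1 :=
  Function.invFunOn_mem ((grotzschMu_bijOn ha).surjOn hy)

theorem grotzschMu_invMu (ha : a ∈ Ioo (0 : ℝ) 1) {y : ℝ} (hy : 0 < y) :
    grotzschMu a (invMu a y) = y :=
  Function.invFunOn_eq ((grotzschMu_bijOn ha).surjOn hy)

theorem invMu_grotzschMu (ha : a ∈ Ioo (0 : ℝ) 1) (hr : r ∈ Ioo (0 : ℝ) 1) :
    invMu a (grotzschMu a r) = r :=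
  (grotzschMu_bijOn ha).injOn.leftInvOn_invFunOn hr

theorem lt_invMu_iff (ha : a ∈ Ioo (0 : ℝ) 1) (hr : r ∈ Ioo (0 : ℝ) 1) {y : ℝ} (hy : 0 < y) :
    r < invMu a y ↔ y < grotzschMu a r := by
  rw [← (grotzschMu_strictAntiOn ha).lt_iff_gt (invMu_mem ha hy) hr, grotzschMu_invMu ha hy]

theorem invMu_lt_iff (ha : a ∈ Ioo (0 : ℝ) 1) (hr : r ∈ Ioo (0 : ℝ) 1) {y : ℝ} (hy : 0 < y) :
    invMu a y < r ↔ grotzschMu a r < y := by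
  rw [← (grotzschMu_strictAntiOn ha).lt_iff_gt hr (invMu_mem ha hy), grotzschMu_invMu ha hy]

theorem invMu_strictAntiOn (ha : a ∈ Ioo (0 : ℝ) 1) : StrictAntiOn (invMu a) (Ioi 0) := by
  intro x hx y hy hxy
  rw [invMu_lt_iff ha (invMu_mem ha hx) hy, grotzschMu_invMu ha hx]
  exact hxy

theorem continuousAt_invMu (ha : a ∈ Ioo (0 : ℝ) 1) {y : ℝ} (hy : 0 < y) :
    ContinuousAt (invMu a) y := by
  have hmono : StrictMonoOn (fun y => -invMu a y) (Ioi 0) :=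
    fun x hx y hy hxy => neg_lt_neg (invMu_strictAntiOn ha hx hy hxy)
  have himage : (fun y => -invMu a y) '' Ioi 0 ∈ 𝓝 (-invMu a y) := by
    refine mem_of_superset (isOpen_Ioo.mem_nhds (show -invMu a y ∈ Ioo (-1 : ℝ) 0 from
      ⟨neg_lt_neg (invMu_mem ha hy).2, neg_neg_of_pos (invMu_mem ha hy).1⟩)) fun x hx => ?_
    have hx' : -x ∈ Ioo (0 : ℝ) 1 := ⟨by linarith [hx.2], by linarith [hx.1]⟩
    exact ⟨grotzschMu a (-x), grotzschMu_pos ha hx', by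
      simp only [invMu_grotzschMu ha hx', neg_neg]⟩
  refine (hmono.continuousAt_of_image_mem_nhds (Ioi_mem_nhds hy) himage).neg.congr
    (Eventually.of_forall fun x => ?_)
  exact neg_neg _

theorem hasDerivAt_invMu (ha : a ∈ Ioo (0 : ℝ) 1) {y : ℝ} (hy : 0 < y) :
    HasDerivAt (invMu a) (-(invMu a y * hypW a (invMu a y))) y := by
  have hmem := invMu_mem ha hy
  have hne : -(invMu a y * hypW a (invMu a y))⁻¹ ≠ 0 :=
    neg_ne_zero.2 (inv_ne_zero (mul_pos hmem.1 (hypW_pos ha hmem)).ne')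
  have h := HasDerivAt.of_local_left_inverse (continuousAt_invMu ha hy)
    (hasDerivAt_grotzschMu ha hmem) hne
    ((eventually_gt_nhds hy).mono fun x hx => grotzschMu_invMu ha hx)
  rwa [inv_neg, inv_inv] at h

theorem hasDerivAt_hypW (ha : a ∈ Ioo (0 : ℝ) 1) (hr : r ∈ Ioo (0 : ℝ) 1) :
    HasDerivAt (hypW a)
      (-hypF a (r ^ 2) * (hypF a (r ^ 2) - 2 * hypB a (r ^ 2)) * (2 * r)) r := by
  have hsq : HasDerivAt (fun r : ℝ => r ^ 2) (2 * r) r := by simpa using hasDerivAt_pow 2 r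
  exact HasDerivAt.comp (h := fun r : ℝ => r ^ 2) r (hasDerivAt_one_sub_mul_hypF_sq ha
    (abs_lt_one_of_mem (Ioo_subset_Ico_self (sq_mem_Ioo hr)))) hsq

theorem tendsto_invMu_zero (ha : a ∈ Ioo (0 : ℝ) 1) : Tendsto (invMu a) (𝓝[>] 0) (𝓝[<] 1) := by
  refine tendsto_nhdsWithin_iff.2 ⟨tendsto_order.2 ⟨fun x hx => ?_, fun x hx => ?_⟩, ?_⟩
  · have hm : max x (1 / 2) ∈ Ioo (0 : ℝ) 1 :=
      ⟨lt_max_of_lt_right (by norm_num), max_lt hx (by norm_num)⟩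
    filter_upwards [Ioo_mem_nhdsGT (grotzschMu_pos ha hm)] with y hy
    exact (le_max_left _ _).trans_lt ((lt_invMu_iff ha hm hy.1).2 hy.2)
  · filter_upwards [self_mem_nhdsWithin] with y hy using (invMu_mem ha hy).2.trans hx
  · filter_upwards [self_mem_nhdsWithin] with y hy using (invMu_mem ha hy).2

theorem tendsto_invMu_atTop (ha : a ∈ Ioo (0 : ℝ) 1) : Tendsto (invMu a) atTop (𝓝[>] 0) := by
  refine tendsto_nhdsWithin_iff.2 ⟨tendsto_order.2 ⟨fun x hx => ?_, fun x hx => ?_⟩, ?_⟩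
  · filter_upwards [eventually_gt_atTop 0] with y hy using hx.trans (invMu_mem ha hy).1
  · have hm : min x (1 / 2) ∈ Ioo (0 : ℝ) 1 :=
      ⟨lt_min hx (by norm_num), min_lt_of_right_lt (by norm_num)⟩
    filter_upwards [eventually_gt_atTop 0, eventually_gt_atTop (grotzschMu a (min x (1 / 2)))]
      with y hy hy'
    exact ((invMu_lt_iff ha hm hy).2 hy').trans_le (min_le_left _ _)
  · filter_upwards [eventually_gt_atTop 0] with y hy using (invMu_mem ha hy).1

theorem logSystem_invMu (ha : a ∈ Ioo (0 : ℝ) 1) :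
    LogSystem (fun y => -Real.log (invMu a y)) (fun y => hypW a (invMu a y))
      (fun y => hypR a (invMu a y ^ 2)) where
  hasDerivAt_X y hy := by
    have hne := (invMu_mem ha hy).1.ne'
    refine ((hasDerivAt_invMu ha hy).log hne).neg.congr_deriv ?_
    field_simp
  hasDerivAt_W y hy := by
    have hmem := invMu_mem ha hy
    refine ((hasDerivAt_hypW ha hmem).comp y (hasDerivAt_invMu ha hy)).congr_deriv ?_
    have h1 := hypF_sq_pos ha hmem
    have h2 := hypF_one_sub_sq_pos ha hmem
    have h3 := sin_pi_mul_pos ha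
    have hy' := grotzschMu_invMu ha hy
    rw [grotzschMu_eq hmem] at hy'
    field_simp at hy'
    rw [eq_div_iff hy.ne', hypR]
    field_simp
    linear_combination (-hypW a (invMu a y)) * invMu a y ^ 2 *
      (hypF a (invMu a y ^ 2) - 2 * hypB a (invMu a y ^ 2)) * hy'
  X_pos y hy := neg_pos.2 (Real.log_neg (invMu_mem ha hy).1 (invMu_mem ha hy).2)
  W_pos y hy := hypW_pos ha (invMu_mem ha hy)
  R_pos y hy := hypR_pos ha (sq_mem_Ioo (invMu_mem ha hy))
  R_strictAnti x hx y hy hxy :=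
    hypR_strictMonoOn ha (sq_mem_Ioo (invMu_mem ha hy)) (sq_mem_Ioo (invMu_mem ha hx))
      (pow_lt_pow_left₀ (invMu_strictAntiOn ha hx hy hxy) (invMu_mem ha hy).1.le two_ne_zero)
  tendsto_X := by
    have h := ((Real.continuousAt_log one_ne_zero).tendsto.comp
      ((tendsto_invMu_zero ha).mono_right nhdsWithin_le_nhds)).neg
    simpa using h
  tendsto_W := by
    have h0 := tendsto_sq_nhdsGT_zero.comp (tendsto_invMu_atTop ha)
    have h1 : Tendsto (fun y => 1 - invMu a y ^ 2) atTop (𝓝 (1 - 0)) :=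
      (h0.mono_right nhdsWithin_le_nhds).const_sub 1
    have h2 := h1.mul (((tendsto_hypF_zero ha).comp h0).pow 2)
    rw [sub_zero, one_pow, one_mul] at h2
    exact h2

/-! ### The logarithm of `φ_K(r)^p / φ_K(r^p)` -/

/-- `-log (φ_K(r)^p / φ_K(r^p))` as a function of `v = 1 / K`. -/
noncomputable def negLogQuot (a p r v : ℝ) : ℝ :=
  p * -Real.log (invMu a (v * grotzschMu a r)) - -Real.log (invMu a (v * grotzschMu a (r ^ p)))

theorem rpow_mem_Ioo {p : ℝ} (hp : 0 < p) (hr : r ∈ Ioo (0 : ℝ) 1) : r ^ p ∈ Ioo (0 : ℝ) 1 :=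
  ⟨Real.rpow_pos_of_pos hr.1 p, Real.rpow_lt_one hr.1.le hr.2 hp⟩

theorem herschPfluger_mem (ha : a ∈ Ioo (0 : ℝ) 1) (hr : r ∈ Ioo (0 : ℝ) 1) {K : ℝ} (hK : 0 < K) :
    herschPfluger K a r ∈ Ioo (0 : ℝ) 1 :=
  invMu_mem ha (div_pos (grotzschMu_pos ha hr) hK)

theorem herschPfluger_eq (K a r : ℝ) : herschPfluger K a r = invMu a (1 / K * grotzschMu a r) := by
  rw [herschPfluger, div_eq_mul_one_div, mul_comm]

theorem herschPfluger_quot_eq (ha : a ∈ Ioo (0 : ℝ) 1) (hr : r ∈ Ioo (0 : ℝ) 1) {p K : ℝ}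
    (hp : 0 < p) (hK : 0 < K) :
    herschPfluger K a r ^ p / herschPfluger K a (r ^ p) =
      Real.exp (-negLogQuot a p r (1 / K)) := by
  have h1 := (herschPfluger_mem ha hr hK).1
  have h2 := (herschPfluger_mem ha (rpow_mem_Ioo hp hr) hK).1
  rw [negLogQuot, ← herschPfluger_eq, ← herschPfluger_eq, neg_sub, mul_neg, sub_neg_eq_add,
    neg_add_eq_sub, Real.exp_sub, Real.exp_log h2, mul_comm, ← Real.rpow_def_of_pos h1]

theorem herschPfluger_one_div_quot_eq (ha : a ∈ Ioo (0 : ℝ) 1) (hr : r ∈ Ioo (0 : ℝ) 1) {p K : ℝ}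
    (hp : 0 < p) (hK : 0 < K) :
    herschPfluger (1 / K) a r ^ p / herschPfluger (1 / K) a (r ^ p) =
      Real.exp (-negLogQuot a p r K) := by
  rw [herschPfluger_quot_eq ha hr hp (one_div_pos.2 hK), one_div_one_div]

theorem secantBounds_negLogQuot (ha : a ∈ Ioo (0 : ℝ) 1) (hr : r ∈ Ioo (0 : ℝ) 1) {p : ℝ}
    (hp0 : 0 < p) (hp1 : p < 1) :
    SecantBounds (negLogQuot a p r) (p * hubnerM a r - hubnerM a (r ^ p))
      (p * grotzschMu a r - grotzschMu a (r ^ p)) := by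
  have hrp := rpow_mem_Ioo hp0 hr
  have h := (logSystem_invMu ha).secantBounds hp0 hp1 (grotzschMu_pos ha hr)
    (grotzschMu_pos ha hrp) (by
      rw [invMu_grotzschMu ha hr, invMu_grotzschMu ha hrp, Real.log_rpow hr.1]
      ring)
  rw [invMu_grotzschMu ha hr, invMu_grotzschMu ha hrp, ← hubnerM_eq ha hr,
    ← hubnerM_eq ha hrp] at h
  exact h

/-- For `p > 1` the roles of `r` and `r ^ p` are exchanged: the quotient for `(p, r)` is the
`(-p)`-th power of the one for `(1 / p, r ^ p)`. -/
theorem negLogQuot_eq_neg_mul (hr : r ∈ Ioo (0 : ℝ) 1) {p : ℝ} (hp : 0 < p) (v : ℝ) :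
    negLogQuot a p r v = -p * negLogQuot a (1 / p) (r ^ p) v := by
  have : (r ^ p) ^ (1 / p) = r := by
    rw [one_div, Real.rpow_rpow_inv hr.1.le hp.ne']
  rw [negLogQuot, negLogQuot, this]
  field_simp
  ring

theorem secantBounds_negLogQuot_one_div (ha : a ∈ Ioo (0 : ℝ) 1) (hr : r ∈ Ioo (0 : ℝ) 1) {p : ℝ}
    (hp : 1 < p) :
    SecantBounds (negLogQuot a (1 / p) (r ^ p)) (1 / p * hubnerM a (r ^ p) - hubnerM a r)
      (1 / p * grotzschMu a (r ^ p) - grotzschMu a r) := by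
  have hp0 : 0 < p := one_pos.trans hp
  have h := secantBounds_negLogQuot ha (rpow_mem_Ioo hp0 hr) (one_div_pos.2 hp0)
    ((div_lt_one hp0).2 hp)
  rwa [one_div, Real.rpow_rpow_inv hr.1.le hp0.ne', ← one_div] at h

theorem mem_Ioo_of_mem_Ioc (ha : a ∈ Ioc (0 : ℝ) (1 / 2)) : a ∈ Ioo (0 : ℝ) 1 :=
  ⟨ha.1, ha.2.trans_lt (by norm_num)⟩

theorem herschPfluger_quot_one (ha : a ∈ Ioo (0 : ℝ) 1) (hr : r ∈ Ioo (0 : ℝ) 1) {K : ℝ}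
    (hK : 0 < K) :
    herschPfluger K a r ^ (1 : ℝ) / herschPfluger K a r = 1 := by
  rw [Real.rpow_one, div_self (herschPfluger_mem ha hr hK).1.ne']

end

/-! ### The equivalences -/

theorem forall_mem_congr {P Q : ℝ → ℝ → Prop}
    (h : ∀ a ∈ Ioo (0 : ℝ) 1, ∀ r ∈ Ioo (0 : ℝ) 1, P a r ↔ Q a r) :
    (∀ a ∈ Ioc (0 : ℝ) (1 / 2), ∀ r ∈ Ioo (0 : ℝ) 1, P a r) ↔
      ∀ a ∈ Ioc (0 : ℝ) (1 / 2), ∀ r ∈ Ioo (0 : ℝ) 1, Q a r :=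
  forall₂_congr fun a ha => forall₂_congr fun r hr => h a (mem_Ioo_of_mem_Ioc ha) r hr

theorem neg_div_le_iff {p : ℝ} (hp : 0 < p) {d x y : ℝ} :
    -d / p ≤ 1 / p * y - x ↔ p * x - y ≤ d := by
  rw [div_le_iff₀ hp, sub_mul, one_div_mul_eq_div, div_mul_cancel₀ _ hp.ne']
  constructor <;> intro h <;> linarith

theorem le_neg_div_iff {p : ℝ} (hp : 0 < p) {d x y : ℝ} :
    1 / p * y - x ≤ -d / p ↔ d ≤ p * x - y := by
  rw [le_div_iff₀ hp, sub_mul, one_div_mul_eq_div, div_mul_cancel₀ _ hp.ne']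
  constructor <;> intro h <;> linarith

theorem theorem4 (δ ζ η : ℝ → ℝ → ℝ) :
    -- `0 < p < 1`
    (∀ p : ℝ, 0 < p → p < 1 →
      ((∀ a ∈ Set.Ioc (0 : ℝ) (1 / 2), ∀ r ∈ Set.Ioo (0 : ℝ) 1, ∀ K : ℝ, 1 < K →
          Real.exp (δ a r * (1 - 1 / K)) <
            herschPfluger K a r ^ p / herschPfluger K a (r ^ p)) ↔
        ∀ a ∈ Set.Ioc (0 : ℝ) (1 / 2), ∀ r ∈ Set.Ioo (0 : ℝ) 1,
          δ a r ≤ p * hubnerM a r - hubnerM a (r ^ p)) ∧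
      ((∀ a ∈ Set.Ioc (0 : ℝ) (1 / 2), ∀ r ∈ Set.Ioo (0 : ℝ) 1, ∀ K : ℝ, 1 < K →
          Real.exp (ζ a r * (1 - K)) <
            herschPfluger (1 / K) a r ^ p / herschPfluger (1 / K) a (r ^ p)) ↔
        ∀ a ∈ Set.Ioc (0 : ℝ) (1 / 2), ∀ r ∈ Set.Ioo (0 : ℝ) 1,
          p * hubnerM a r - hubnerM a (r ^ p) ≤ ζ a r) ∧
      ((∀ a ∈ Set.Ioc (0 : ℝ) (1 / 2), ∀ r ∈ Set.Ioo (0 : ℝ) 1, ∀ K : ℝ, 1 < K →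
          herschPfluger (1 / K) a r ^ p / herschPfluger (1 / K) a (r ^ p) <
            Real.exp (η a r * (1 - K))) ↔
        ∀ a ∈ Set.Ioc (0 : ℝ) (1 / 2), ∀ r ∈ Set.Ioo (0 : ℝ) 1,
          η a r ≤ p * grotzschMu a r - grotzschMu a (r ^ p))) ∧
    -- `p = 1`, with non-strict inequalities
    (∀ p : ℝ, p = 1 →
      ((∀ a ∈ Set.Ioc (0 : ℝ) (1 / 2), ∀ r ∈ Set.Ioo (0 : ℝ) 1, ∀ K : ℝ, 1 < K →
          Real.exp (δ a r * (1 - 1 / K)) ≤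
            herschPfluger K a r ^ p / herschPfluger K a (r ^ p)) ↔
        ∀ a ∈ Set.Ioc (0 : ℝ) (1 / 2), ∀ r ∈ Set.Ioo (0 : ℝ) 1,
          δ a r ≤ p * hubnerM a r - hubnerM a (r ^ p)) ∧
      ((∀ a ∈ Set.Ioc (0 : ℝ) (1 / 2), ∀ r ∈ Set.Ioo (0 : ℝ) 1, ∀ K : ℝ, 1 < K →
          Real.exp (ζ a r * (1 - K)) ≤
            herschPfluger (1 / K) a r ^ p / herschPfluger (1 / K) a (r ^ p)) ↔
        ∀ a ∈ Set.Ioc (0 : ℝ) (1 / 2), ∀ r ∈ Set.Ioo (0 : ℝ) 1,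
          p * hubnerM a r - hubnerM a (r ^ p) ≤ ζ a r) ∧
      ((∀ a ∈ Set.Ioc (0 : ℝ) (1 / 2), ∀ r ∈ Set.Ioo (0 : ℝ) 1, ∀ K : ℝ, 1 < K →
          herschPfluger (1 / K) a r ^ p / herschPfluger (1 / K) a (r ^ p) ≤
            Real.exp (η a r * (1 - K))) ↔
        ∀ a ∈ Set.Ioc (0 : ℝ) (1 / 2), ∀ r ∈ Set.Ioo (0 : ℝ) 1,
          η a r ≤ p * grotzschMu a r - grotzschMu a (r ^ p))) ∧
    -- `p > 1`
    (∀ p : ℝ, 1 < p →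
      ((∀ a ∈ Set.Ioc (0 : ℝ) (1 / 2), ∀ r ∈ Set.Ioo (0 : ℝ) 1, ∀ K : ℝ, 1 < K →
          herschPfluger K a r ^ p / herschPfluger K a (r ^ p) <
            Real.exp (δ a r * (1 - 1 / K))) ↔
        ∀ a ∈ Set.Ioc (0 : ℝ) (1 / 2), ∀ r ∈ Set.Ioo (0 : ℝ) 1,
          p * hubnerM a r - hubnerM a (r ^ p) ≤ δ a r) ∧
      ((∀ a ∈ Set.Ioc (0 : ℝ) (1 / 2), ∀ r ∈ Set.Ioo (0 : ℝ) 1, ∀ K : ℝ, 1 < K →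
          Real.exp (ζ a r * (1 - K)) <
            herschPfluger (1 / K) a r ^ p / herschPfluger (1 / K) a (r ^ p)) ↔
        ∀ a ∈ Set.Ioc (0 : ℝ) (1 / 2), ∀ r ∈ Set.Ioo (0 : ℝ) 1,
          p * grotzschMu a r - grotzschMu a (r ^ p) ≤ ζ a r) ∧
      ((∀ a ∈ Set.Ioc (0 : ℝ) (1 / 2), ∀ r ∈ Set.Ioo (0 : ℝ) 1, ∀ K : ℝ, 1 < K →
          herschPfluger (1 / K) a r ^ p / herschPfluger (1 / K) a (r ^ p) <
            Real.exp (η a r * (1 - K))) ↔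
        ∀ a ∈ Set.Ioc (0 : ℝ) (1 / 2), ∀ r ∈ Set.Ioo (0 : ℝ) 1,
          η a r ≤ p * hubnerM a r - hubnerM a (r ^ p))) := by
  refine ⟨fun p hp0 hp1 => ⟨?_, ?_, ?_⟩, ?_, fun p hp1 => ⟨?_, ?_, ?_⟩⟩
  · refine forall_mem_congr fun a ha r hr => ?_
    rw [← (secantBounds_negLogQuot ha hr hp0 hp1).forall_left_iff]
    refine forall₂_congr fun K hK => ?_
    rw [herschPfluger_quot_eq ha hr hp0 (by linarith), Real.exp_lt_exp]
  · refine forall_mem_congr fun a ha r hr => ?_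
    rw [← (secantBounds_negLogQuot ha hr hp0 hp1).forall_right_lt_iff]
    refine forall₂_congr fun K hK => ?_
    rw [herschPfluger_one_div_quot_eq ha hr hp0 (by linarith), Real.exp_lt_exp]
  · refine forall_mem_congr fun a ha r hr => ?_
    rw [← (secantBounds_negLogQuot ha hr hp0 hp1).forall_right_gt_iff]
    refine forall₂_congr fun K hK => ?_
    rw [herschPfluger_one_div_quot_eq ha hr hp0 (by linarith), Real.exp_lt_exp]
  · -- for `p = 1` the quotient is `1`, and a single value of `K` determines the sign
    rintro p rfl
    refine ⟨?_, ?_, ?_⟩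
    · refine forall_mem_congr fun a ha r hr => ?_
      rw [one_mul, Real.rpow_one r, sub_self]
      refine ⟨fun H => ?_, fun H K hK => ?_⟩
      · have h := H 2 (by norm_num)
        rw [herschPfluger_quot_one ha hr two_pos, Real.exp_le_one_iff] at h
        linarith
      · have hK0 : 0 < K := by linarith
        rw [herschPfluger_quot_one ha hr hK0, Real.exp_le_one_iff]
        exact mul_nonpos_of_nonpos_of_nonneg H (sub_nonneg.2 ((div_le_one hK0).2 hK.le))
    · refine forall_mem_congr fun a ha r hr => ?_
      rw [one_mul, Real.rpow_one r, sub_self]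
      refine ⟨fun H => ?_, fun H K hK => ?_⟩
      · have h := H 2 (by norm_num)
        rw [herschPfluger_quot_one ha hr (one_div_pos.2 two_pos), Real.exp_le_one_iff] at h
        linarith
      · rw [herschPfluger_quot_one ha hr (one_div_pos.2 (by linarith)), Real.exp_le_one_iff]
        exact mul_nonpos_of_nonneg_of_nonpos H (by linarith)
    · refine forall_mem_congr fun a ha r hr => ?_
      rw [one_mul, Real.rpow_one r, sub_self]
      refine ⟨fun H => ?_, fun H K hK => ?_⟩
      · have h := H 2 (by norm_num)
        rw [herschPfluger_quot_one ha hr (one_div_pos.2 two_pos), Real.one_le_exp_iff] at h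
        linarith
      · rw [herschPfluger_quot_one ha hr (one_div_pos.2 (by linarith)), Real.one_le_exp_iff]
        exact mul_nonneg_of_nonpos_of_nonpos H (by linarith)
  -- for `p > 1` the negative factor `-p` between the two logarithms reverses the inequalities
  · have hp0 : 0 < p := one_pos.trans hp1
    refine forall_mem_congr fun a ha r hr => ?_
    have hiff := (secantBounds_negLogQuot_one_div ha hr hp1).forall_left_iff (-δ a r / p)
    rw [neg_div_le_iff hp0] at hiff
    rw [← hiff]
    refine forall₂_congr fun K hK => ?_
    rw [herschPfluger_quot_eq ha hr hp0 (by linarith), Real.exp_lt_exp,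
      negLogQuot_eq_neg_mul hr hp0, neg_mul, neg_neg, neg_div, neg_mul, neg_lt_neg_iff,
      div_mul_eq_mul_div, lt_div_iff₀' hp0]
  · have hp0 : 0 < p := one_pos.trans hp1
    refine forall_mem_congr fun a ha r hr => ?_
    have hiff := (secantBounds_negLogQuot_one_div ha hr hp1).forall_right_gt_iff (-ζ a r / p)
    rw [neg_div_le_iff hp0] at hiff
    rw [← hiff]
    refine forall₂_congr fun K hK => ?_
    rw [herschPfluger_one_div_quot_eq ha hr hp0 (by linarith), Real.exp_lt_exp,
      negLogQuot_eq_neg_mul hr hp0, neg_mul, neg_neg, neg_div, neg_mul, neg_lt_neg_iff,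
      div_mul_eq_mul_div, div_lt_iff₀' hp0]
  · have hp0 : 0 < p := one_pos.trans hp1
    refine forall_mem_congr fun a ha r hr => ?_
    have hiff := (secantBounds_negLogQuot_one_div ha hr hp1).forall_right_lt_iff (-η a r / p)
    rw [le_neg_div_iff hp0] at hiff
    rw [← hiff]
    refine forall₂_congr fun K hK => ?_
    rw [herschPfluger_one_div_quot_eq ha hr hp0 (by linarith), Real.exp_lt_exp,
      negLogQuot_eq_neg_mul hr hp0, neg_mul, neg_neg, neg_div, neg_mul, neg_lt_neg_iff,
      div_mul_eq_mul_div, lt_div_iff₀' hp0]
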